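/- Let $k$ be a field, let $\mathbb{P}=\{1,2,3,\dots\}$, and let $r\ge 1$. Let $\Lambda$ be a stack polyomino, that is, a finite subset of $\mathbb{P}^2$ such that (i) if $(a,b)\in\Lambda$ then $(c,b)\in\Lambda$ for $1\le c\le a$, and (ii) if $(a,b_1),(a,b_2)\in\Lambda$ and $b_1\le d\le b_2$ then $(a,d)\in\Lambda$. Let $R_\Lambda=k[x_{ab}:(a,b)\in\Lambda]$, and let $D_{\Lambda,r}\subseteq R_\Lambda$ be the ideal generated by the minors $\det(x_{ab})_{a\in\alpha,\,b\in\beta}$ for all $\alpha,\beta\subset\mathbb{P}$ with $|\alpha|=|\beta|=r$ and $\alpha\times\beta\subseteq\Lambda$. Order the variables by $x_{ij}\prec x_{kl}$ if $i>k$, or if $i=k$ and $j<l$, and extend $\preceq$ to monomials by the graded reverse lexicographic term order: $m\prec m'$ if and only if $\deg m<\deg m'$, or $\deg m=\deg m'$ and, at the $\prec$-smallest variable whose exponents in $m$ and $m'$ differ, the exponent in $m$ is the larger one. For an ideal $J\subseteq R_\Lambda$ let $\mathrm{in}_\preceq(J)$ be the ideal generated by the leading monomials of the nonzero elements of $J$.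 An $r$-diagonal in $\Lambda$ is a set $\{(a_1,b_1),\dots,(a_r,b_r)\}$ with $a_1<\dots<a_r$, $b_1<\dots<b_r$ and $(a_i,b_j)\in\Lambda$ for all $1\le i,j\le r$. Let $\Delta_{\Lambda,r-1}$ be the simplicial complex of all subsets of $\Lambda$ that contain no $r$-diagonal in $\Lambda$, and let $I_{\Delta_{\Lambda,r-1}}\subseteq R_\Lambda$ be its Stanley--Reisner ideal, generated by the monomials $\prod_{(a,b)\in\sigma}x_{ab}$ for all $\sigma\subseteq\Lambda$ with $\sigma\notin\Delta_{\Lambda,r-1}$. Then $$\mathrm{in}_\preceq(D_{\Lambda,r}) = I_{\Delta_{\Lambda,r-1}}.$$ In particular, $\mathrm{in}_\preceq(D_{\Lambda,r})$ is generated by squarefree monomials. -/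

import Mathlib

/-! ### The graded reverse lexicographic order -/

/-- Exponent vectors, to be ordered by the graded reverse lexicographic order. -/
def DegRevLex (V : Type*) := V →₀ ℕ

namespace DegRevLex

variable {V : Type*}

noncomputable instance : AddCommMonoid (DegRevLex V) :=
  inferInstanceAs (AddCommMonoid (V →₀ ℕ))

/-- The identity, from exponent vectors to their ordered synonym. -/
noncomputable def equiv : (V →₀ ℕ) ≃+ DegRevLex V := AddEquiv.refl _

/-- The key that is compared: first the degree, then the exponent vectors in the reversed
lexicographic order, where the entry at the smallest variable is compared first. -/
noncomputable def key [LinearOrder V] (m : DegRevLex V) : ℕ ×ₗ (Lex (V →₀ ℕ))ᵒᵈ :=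
  toLex (Finsupp.degree (equiv.symm m), OrderDual.toDual (toLex (equiv.symm m)))

theorem key_injective [LinearOrder V] : Function.Injective (key : DegRevLex V → _) := by
  intro m n h
  have h2 := congrArg (fun p => ofLex (OrderDual.ofDual (ofLex p).2)) h
  exact h2

noncomputable instance [LinearOrder V] : LinearOrder (DegRevLex V) :=
  LinearOrder.lift' key key_injective

theorem lt_def [LinearOrder V] {m n : V →₀ ℕ} :
    equiv m < equiv n ↔ m.degree < n.degree ∨
      (m.degree = n.degree ∧ ∃ i, (∀ j < i, m j = n j) ∧ n i < m i) := by
  change key (equiv m) < key (equiv n) ↔ _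
  simp only [key, AddEquiv.symm_apply_apply, Prod.Lex.toLex_lt_toLex, OrderDual.toDual_lt_toDual,
    Finsupp.Lex.lt_iff, ofLex_toLex]
  simp only [eq_comm]

theorem le_def [LinearOrder V] {m n : V →₀ ℕ} :
    equiv m ≤ equiv n ↔ m.degree < n.degree ∨
      (m.degree = n.degree ∧ toLex n ≤ toLex m) := by
  change key (equiv m) ≤ key (equiv n) ↔ _
  simp only [key, AddEquiv.symm_apply_apply, Prod.Lex.toLex_le_toLex, OrderDual.toDual_le_toDual]

instance [LinearOrder V] : IsOrderedAddMonoid (DegRevLex V) where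
  add_le_add_left a b h c := by
    obtain ⟨a, rfl⟩ := equiv.surjective a
    obtain ⟨b, rfl⟩ := equiv.surjective b
    obtain ⟨c, rfl⟩ := equiv.surjective c
    rw [← map_add, ← map_add]
    rw [le_def] at h ⊢
    simpa [toLex_add] using h

instance [LinearOrder V] [Finite V] : WellFoundedLT (DegRevLex V) := by
  have : ∀ x : DegRevLex V, (Set.Iio x).Finite := by
    intro x
    refine (Finsupp.finite_of_degree_le (σ := V) (Finsupp.degree (equiv.symm x))).subset ?_
    intro y hy
    have hy' : equiv (equiv.symm y) < equiv (equiv.symm x) := hy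
    rw [lt_def] at hy'
    rcases hy' with h | h
    · exact h.le
    · exact h.1.le
  refine ⟨Subrelation.wf (r := (measure fun x : DegRevLex V => (Set.Iio x).ncard).rel) ?_
    (measure _).wf⟩
  intro y x h
  exact Set.ncard_lt_ncard (Set.Iio_ssubset_Iio h) (this x)

end DegRevLex

/-- The graded reverse lexicographic term order on the monomials in the variables `V`: the monomial
`m` is smaller than `n` if its degree is smaller, or if the degrees agree and, at the smallest
variable where the exponents differ, `m` has the larger exponent. Equivalently, for equal degrees,
the word of the variables of `m` in increasing order is lexicographically smaller than that
of `n`. -/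
noncomputable def degRevLex (V : Type*) [LinearOrder V] [Finite V] : MonomialOrder V where
  syn := DegRevLex V
  toSyn := DegRevLex.equiv
  toSyn_monotone a b h := by
    rcases h.eq_or_lt with rfl | h
    · exact le_rfl
    · rw [DegRevLex.le_def]
      left
      obtain ⟨c, rfl⟩ := exists_add_of_le h.le
      have hc : c ≠ 0 := by rintro rfl; simp at h
      have : c.degree ≠ 0 := by simpa [Finsupp.degree_eq_zero_iff] using hc
      rw [map_add]
      omega

/-! ### Initial ideals and Stanley-Reisner ideals -/

/-- The leading monomial of `f` (with coefficient one), which is `0` for `f = 0`. -/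
noncomputable def leadingMonomial {V k : Type*} [Field k] (ord : MonomialOrder V)
    (f : MvPolynomial V k) : MvPolynomial V k :=
  open Classical in if f = 0 then 0 else MvPolynomial.monomial (ord.degree f) 1

/-- The initial ideal of `J`, generated by the leading monomials of all elements of `J`. -/
noncomputable def initialIdeal {V k : Type*} [Field k] (ord : MonomialOrder V)
    (J : Ideal (MvPolynomial V k)) : Ideal (MvPolynomial V k) :=
  Ideal.span {g | ∃ f ∈ J, g = leadingMonomial ord f}

/-- The Stanley-Reisner ideal of a simplicial complex `Δ` on the ground set `V`, that is, of a
family of finite subsets of `V` that is closed under taking subsets. It is generated by the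
squarefree monomials of the nonfaces. -/
noncomputable def stanleyReisnerIdeal {V : Type*} (k : Type*) [Field k]
    (Δ : LowerSet (Finset V)) : Ideal (MvPolynomial V k) :=
  Ideal.span {f | ∃ σ : Finset V, σ ∉ Δ ∧ f = ∏ v ∈ σ, MvPolynomial.X v}

/-- `I` is generated by a set of squarefree monomials. -/
def IsSquarefreeMonomialIdeal {V k : Type*} [Field k] (I : Ideal (MvPolynomial V k)) : Prop :=
  ∃ S : Set (V →₀ ℕ), (∀ m ∈ S, ∀ v, m v ≤ 1) ∧
    I = Ideal.span ((fun m => MvPolynomial.monomial m (1 : k)) '' S)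

/-! ### Stack polyominoes and their minors -/

/-- Stack polyominoes: finite sets of positions `(row, column)` of which each column is an
initial segment and each row is an interval. -/
structure IsStackPolyomino (Λ : Finset (ℕ+ × ℕ+)) : Prop where
  column : ∀ a b, (a, b) ∈ Λ → ∀ c ≤ a, (c, b) ∈ Λ
  row : ∀ a b₁ b₂, (a, b₁) ∈ Λ → (a, b₂) ∈ Λ → ∀ d, b₁ ≤ d → d ≤ b₂ → (a, d) ∈ Λ

/-- The elements of `Λ`, as indices of variables. This is a separate type since its order is not
the componentwise one. -/
def Cell (Λ : Finset (ℕ+ × ℕ+)) : Type := {p : ℕ+ × ℕ+ // p ∈ Λ}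

namespace Cell

variable {Λ : Finset (ℕ+ × ℕ+)}

instance : Finite (Cell Λ) := inferInstanceAs (Finite {p : ℕ+ × ℕ+ // p ∈ Λ})

/-- The position of a cell. -/
def pos : Cell Λ ↪ ℕ+ × ℕ+ := ⟨Subtype.val, Subtype.val_injective⟩

/-- Lower rows come first, and each row is ordered from left to right. -/
noncomputable instance : LinearOrder (Cell Λ) :=
  LinearOrder.lift' (fun x : Cell Λ => toLex (OrderDual.toDual (pos x).1, (pos x).2))
    (fun x y h => by
      have h' := toLex.injective h
      simp only [Prod.mk.injEq, EmbeddingLike.apply_eq_iff_eq] at h'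
      exact pos.injective (Prod.ext h'.1 h'.2))

theorem lt_def {x y : Cell Λ} :
    x < y ↔ (pos x).1 > (pos y).1 ∨ ((pos x).1 = (pos y).1 ∧ (pos x).2 < (pos y).2) := by
  change toLex (OrderDual.toDual (pos x).1, (pos x).2) <
    toLex (OrderDual.toDual (pos y).1, (pos y).2) ↔ _
  simp [Prod.Lex.toLex_lt_toLex]

end Cell

/-- The matrix with the variable `x_{ab}` at the positions `(a, b) ∈ Λ` and `0` elsewhere. -/
noncomputable def genericMatrix (k : Type*) [Field k] (Λ : Finset (ℕ+ × ℕ+)) :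
    Matrix ℕ+ ℕ+ (MvPolynomial (Cell Λ) k) :=
  fun a b => if h : (a, b) ∈ Λ then MvPolynomial.X (⟨(a, b), h⟩ : Cell Λ) else 0

/-- The minor with row set `α` and column set `β` if `α × β` lies in `Λ`, and `0` otherwise. -/
noncomputable def minorOf (k : Type*) [Field k] (Λ : Finset (ℕ+ × ℕ+)) {r : ℕ}
    (α β : Finset ℕ+) (hα : α.card = r) (hβ : β.card = r) : MvPolynomial (Cell Λ) k :=
  if α ×ˢ β ⊆ Λ then
    ((genericMatrix k Λ).submatrix (α.orderEmbOfFin hα) (β.orderEmbOfFin hβ)).det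
  else 0

/-- The ideal generated by the `r`-minors that lie in `Λ`. -/
noncomputable def determinantalIdeal (k : Type*) [Field k] (Λ : Finset (ℕ+ × ℕ+)) (r : ℕ) :
    Ideal (MvPolynomial (Cell Λ) k) :=
  Ideal.span {f | ∃ (α β : Finset ℕ+) (hα : α.card = r) (hβ : β.card = r),
    f = minorOf k Λ α β hα hβ}

/-- The set `τ` forms an `r`-diagonal in `Λ`. -/
def IsDiagonal (Λ : Finset (ℕ+ × ℕ+)) (r : ℕ) (τ : Finset (ℕ+ × ℕ+)) : Prop :=
  ∃ a b : Fin r → ℕ+, StrictMono a ∧ StrictMono b ∧ (∀ i j, (a i, b j) ∈ Λ) ∧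
    τ = Finset.univ.image fun i => (a i, b i)

/-- The simplicial complex of all subsets of `Λ` that contain no `r`-diagonal in `Λ`. For `r ≥ 1`
this is the complex written `Δ_{Λ, r-1}`. -/
def diagonalFreeComplex (Λ : Finset (ℕ+ × ℕ+)) (r : ℕ) : LowerSet (Finset (Cell Λ)) where
  carrier := {σ | ¬ ∃ τ, IsDiagonal Λ r τ ∧ τ ⊆ σ.map Cell.pos}
  lower' := fun _ _ hst hs ⟨τ, hτ, h⟩ => hs ⟨τ, hτ, h.trans (Finset.map_subset_map.2 hst)⟩

/-! Every diagonal is the leading monomial of a minor, since the diagonal term of a minor beats its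
other terms in this order (`permExponent_lt`). This gives one inclusion. By division by the minors,
the other follows once every element of the determinantal ideal whose monomials are all supported on
faces is zero (`eq_zero_of_mem_determinantalIdeal`).

For this, `stairPos` places the polyomino in a triangular array of cells `(a, b)` with `a < b ≤ n`.
Minors become minors, and `r` cells form a diagonal as soon as their images form an `r`-crossing:
rows `α i` and columns `β i` both increase and `α i < β j` for all `i, j`. So it suffices that a
polynomial with crossing-free monomials is zero if it vanishes on all arrays with vanishing
`r`-minors (`eq_zero_of_vanishes_of_minors`). An array is read as the parameters of a product of
elementary matrices along the staircase word; they reappear as the entries of the product above the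
antidiagonal (`wordMatrix_stairWord`). If the product lies in the opposite Bruhat cell of `middleRev
n r`, a rank bound makes these minors vanish (`InCell.det_submatrix_eq_zero`).

Hence the polynomial vanishes wherever the product lies in this cell. Now remove the letters of the
word from the left, each time passing to the leading coefficient in the variable of the letter. If
the variable does not occur, the permutation undergoes a comparison at `j, j + 1`. If it occurs, it
is sent to infinity and the permutation stays as it is (`InCell.exists_curve`). At the end a
constant remains, and it vanishes if the permutation has become the identity
(`eq_zero_of_vanishes_on_cell`). For a crossing-free monomial it has: a small value that arrives too
late can be traced back through skipped comparisons that form an `r`-crossing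
(`exists_diagonal_of_smallCount_lt`). -/

/-! ### Products of elementary matrices and opposite Bruhat cells -/

section BruhatCells

open Matrix

/-- The matrix that agrees with the identity except for the block `[x, 1; 1, 0]` at the positions
`j, j + 1`. -/
def crossMatrix {R : Type*} [CommRing R] {n : ℕ} (j : Fin n) (x : R) :
    Matrix (Fin (n + 1)) (Fin (n + 1)) R :=
  Matrix.of fun a c =>
    if a = j.castSucc then (if c = j.castSucc then x else if c = j.succ then 1 else 0)
    else if a = j.succ then (if c = j.castSucc then 1 else 0)
    else if a = c then 1 else 0

/-- The inverse of `crossMatrix j x`. -/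
def crossMatrixInv {R : Type*} [CommRing R] {n : ℕ} (j : Fin n) (x : R) :
    Matrix (Fin (n + 1)) (Fin (n + 1)) R :=
  Matrix.of fun a c =>
    if a = j.castSucc then (if c = j.succ then 1 else 0)
    else if a = j.succ then (if c = j.castSucc then 1 else if c = j.succ then -x else 0)
    else if a = c then 1 else 0

/-! ### Words of elementary matrices over a commutative ring -/

section Ring

variable {R : Type*} [CommRing R] {n : ℕ}

theorem castSucc_ne_succ (j : Fin n) : j.castSucc ≠ j.succ := (Fin.castSucc_lt_succ).ne

theorem crossMatrix_mul_apply (j : Fin n) (x : R) (M : Matrix (Fin (n + 1)) (Fin (n + 1)) R)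
    (a c : Fin (n + 1)) : (crossMatrix j x * M) a c =
      if a = j.castSucc then x * M j.castSucc c + M j.succ c
      else if a = j.succ then M j.castSucc c else M a c := by
  have hj := castSucc_ne_succ j
  rw [Matrix.mul_apply]
  by_cases h1 : a = j.castSucc
  · rw [if_pos h1, Finset.sum_eq_add_of_mem j.castSucc j.succ (Finset.mem_univ _)
      (Finset.mem_univ _) hj]
    · simp [crossMatrix, h1, hj.symm]
    · rintro b - ⟨h2, h3⟩
      simp [crossMatrix, h1, h2, h3]
  · rw [if_neg h1]
    by_cases h2 : a = j.succ
    · rw [if_pos h2, Finset.sum_eq_single j.castSucc]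
      · simp [crossMatrix, h2, hj.symm]
      · intro b _ hb
        simp [crossMatrix, h2, hj.symm, hb]
      · simp
    · rw [if_neg h2, Finset.sum_eq_single a]
      · simp [crossMatrix, h1, h2]
      · intro b _ hb
        simp [crossMatrix, h1, h2, hb.symm]
      · simp

theorem mul_crossMatrix_apply (j : Fin n) (x : R) (M : Matrix (Fin (n + 1)) (Fin (n + 1)) R)
    (a c : Fin (n + 1)) : (M * crossMatrix j x) a c =
      if c = j.castSucc then x * M a j.castSucc + M a j.succ
      else if c = j.succ then M a j.castSucc else M a c := by
  have ht : (crossMatrix j x)ᵀ = crossMatrix j x := by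
    have hj := castSucc_ne_succ j
    ext a c
    simp only [crossMatrix, transpose_apply, of_apply]
    grind
  have := crossMatrix_mul_apply j x Mᵀ c a
  rw [← ht, ← transpose_mul, transpose_apply] at this
  simpa using this

theorem crossMatrixInv_mul_apply (j : Fin n) (x : R) (M : Matrix (Fin (n + 1)) (Fin (n + 1)) R)
    (a c : Fin (n + 1)) : (crossMatrixInv j x * M) a c =
      if a = j.castSucc then M j.succ c
      else if a = j.succ then M j.castSucc c - x * M j.succ c else M a c := by
  have hj := castSucc_ne_succ j
  rw [Matrix.mul_apply]
  by_cases h1 : a = j.castSucc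
  · rw [if_pos h1, Finset.sum_eq_single j.succ]
    · simp [crossMatrixInv, h1]
    · intro b _ hb
      simp [crossMatrixInv, h1, hb]
    · simp
  · rw [if_neg h1]
    by_cases h2 : a = j.succ
    · rw [if_pos h2, Finset.sum_eq_add_of_mem j.castSucc j.succ (Finset.mem_univ _)
        (Finset.mem_univ _) hj]
      · simp [crossMatrixInv, h2, hj.symm, sub_eq_add_neg]
      · rintro b - ⟨h3, h4⟩
        simp [crossMatrixInv, h2, h3, h4]
    · rw [if_neg h2, Finset.sum_eq_single a]
      · simp [crossMatrixInv, h1, h2]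
      · intro b _ hb
        simp [crossMatrixInv, h1, h2, hb.symm]
      · simp

theorem crossMatrix_mul_crossMatrixInv (j : Fin n) (x : R) :
    crossMatrix j x * crossMatrixInv j x = 1 := by
  have hj := castSucc_ne_succ j
  ext a c
  rw [crossMatrix_mul_apply]
  simp only [crossMatrixInv, of_apply, one_apply]
  grind

theorem crossMatrixInv_mul_crossMatrix (j : Fin n) (x : R) :
    crossMatrixInv j x * crossMatrix j x = 1 :=
  mul_eq_one_comm.1 (crossMatrix_mul_crossMatrixInv j x)

theorem map_crossMatrix {S : Type*} [CommRing S] (φ : R →+* S) (j : Fin n) (x : R) :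
    (crossMatrix j x).map φ = crossMatrix j (φ x) := by
  ext a c
  simp only [crossMatrix, map_apply, of_apply]
  split_ifs <;> simp

theorem map_crossMatrixInv {S : Type*} [CommRing S] (φ : R →+* S) (j : Fin n) (x : R) :
    (crossMatrixInv j x).map φ = crossMatrixInv j (φ x) := by
  ext a c
  simp only [crossMatrixInv, map_apply, of_apply]
  split_ifs <;> simp

/-- The product of the matrices `crossMatrix j x` over the entries of a list. -/
def wordMatrix (L : List (Fin n × R)) : Matrix (Fin (n + 1)) (Fin (n + 1)) R :=
  (L.map fun p => crossMatrix p.1 p.2).prod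

@[simp]
theorem wordMatrix_nil : wordMatrix ([] : List (Fin n × R)) = 1 := by
  simp [wordMatrix]

@[simp]
theorem wordMatrix_cons (p : Fin n × R) (L : List (Fin n × R)) :
    wordMatrix (p :: L) = crossMatrix p.1 p.2 * wordMatrix L := by
  simp [wordMatrix]

theorem wordMatrix_append (L L' : List (Fin n × R)) :
    wordMatrix (L ++ L') = wordMatrix L * wordMatrix L' := by
  simp [wordMatrix]

theorem map_wordMatrix {S : Type*} [CommRing S] (φ : R →+* S) (L : List (Fin n × R)) :
    (wordMatrix L).map φ = wordMatrix (L.map fun p => (p.1, φ p.2)) := by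
  induction L with
  | nil => simp
  | cons p L ih => simp [Matrix.map_mul, ih, map_crossMatrix]

/-- Upper triangular matrices with ones on the diagonal. -/
def IsUpperUnipotent (u : Matrix (Fin (n + 1)) (Fin (n + 1)) R) : Prop :=
  (∀ a c, c < a → u a c = 0) ∧ ∀ a, u a a = 1

/-- Moving an upper unipotent matrix through one factor. -/
theorem IsUpperUnipotent.conj {u : Matrix (Fin (n + 1)) (Fin (n + 1)) R}
    (hu : IsUpperUnipotent u) (j : Fin n) (x : R) :
    IsUpperUnipotent
      (crossMatrixInv j (x + u j.castSucc j.succ) * (u * crossMatrix j x)) := by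
  have hj : j.castSucc < j.succ := Fin.castSucc_lt_succ
  obtain ⟨h0, h1⟩ := hu
  constructor
  -- The critical entry is the one at `(j + 1, j)`: it equals `x + u j (j + 1)` minus the new
  -- parameter.
  · intro a c hac
    simp only [crossMatrixInv_mul_apply, mul_crossMatrix_apply]
    have key : ∀ b : Fin (n + 1), b < j.succ ↔ b ≤ j.castSucc := fun b => by
      simp [Fin.lt_def, Fin.le_def]
    have hs : u j.succ j.castSucc = 0 := h0 _ _ hj
    split_ifs <;> grind
  · intro a
    simp only [crossMatrixInv_mul_apply, mul_crossMatrix_apply]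
    have hs : u j.succ j.castSucc = 0 := h0 _ _ hj
    split_ifs <;> grind

/-- Upper unipotent matrices act on the matrices of a word from the left, up to upper unipotent
matrices on the right. The action is trivial wherever the acting matrix is. -/
theorem exists_wordMatrix_eq_mul {S : Type*} [CommRing S] (φ : R →+* S) {l : ℕ}
    (q : Fin l → Fin n) (z : Fin l → R) (u : Matrix (Fin (n + 1)) (Fin (n + 1)) R)
    (hu : IsUpperUnipotent u) (hφ : u.map φ = 1) :
    ∃ (z' : Fin l → R) (u' : Matrix (Fin (n + 1)) (Fin (n + 1)) R),
      IsUpperUnipotent u' ∧ (∀ i, φ (z' i) = φ (z i)) ∧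
      u * wordMatrix (List.ofFn fun i => (q i, z i)) =
        wordMatrix (List.ofFn fun i => (q i, z' i)) * u' := by
  induction l generalizing u with
  | zero => exact ⟨z, u, hu, fun _ => rfl, by simp⟩
  | succ l ih =>
    set y : R := z 0 + u (q 0).castSucc (q 0).succ with hy
    set v := crossMatrixInv (q 0) y * (u * crossMatrix (q 0) (z 0)) with hv
    have hφy : φ y = φ (z 0) := by
      have := congrFun (congrFun hφ (q 0).castSucc) (q 0).succ
      rw [map_apply, one_apply_ne (castSucc_ne_succ _)] at this
      rw [hy, map_add, this, add_zero]
    have hvφ : v.map φ = 1 := by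
      rw [hv, Matrix.map_mul, Matrix.map_mul, hφ, one_mul, map_crossMatrix, map_crossMatrixInv,
        hφy, crossMatrixInv_mul_crossMatrix]
    obtain ⟨z', u', hu', hz', h⟩ := ih (fun i => q i.succ) (fun i => z i.succ) v (hu.conj _ _) hvφ
    refine ⟨Fin.cons y z', u', hu', ?_, ?_⟩
    · intro i
      refine Fin.cases ?_ (fun i => ?_) i
      · simpa using hφy
      · simpa using hz' i
    · simp only [List.ofFn_succ, wordMatrix_cons, Fin.cons_zero, Fin.cons_succ]
      rw [mul_assoc, ← h, hv, ← mul_assoc (crossMatrix (q 0) y), ← mul_assoc (crossMatrix (q 0) y),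
        crossMatrix_mul_crossMatrixInv, one_mul, mul_assoc]

/-- The matrix `M` is the product of a lower triangular matrix with nonzero diagonal entries, of the
permutation matrix of `σ` and of an upper triangular matrix. -/
def InCell (σ : Equiv.Perm (Fin (n + 1))) (M : Matrix (Fin (n + 1)) (Fin (n + 1)) R) : Prop :=
  ∃ L U : Matrix (Fin (n + 1)) (Fin (n + 1)) R, (∀ a c, a < c → L a c = 0) ∧
    (∀ a, L a a ≠ 0) ∧ (∀ a c, c < a → U a c = 0) ∧ M = L * U.submatrix σ id

end Ring

/-! ### Moving between cells over a field -/

section Field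

variable {K : Type*} [Field K] {n : ℕ}

theorem InCell.mul_right {σ : Equiv.Perm (Fin (n + 1))}
    {M u : Matrix (Fin (n + 1)) (Fin (n + 1)) K} (h : InCell σ M)
    (hu : ∀ a c, c < a → u a c = 0) : InCell σ (M * u) := by
  obtain ⟨L, U, h1, h2, h3, rfl⟩ := h
  refine ⟨L, U * u, h1, h2, fun a c hac => ?_, ?_⟩
  · rw [Matrix.mul_apply]
    refine Finset.sum_eq_zero fun b _ => ?_
    rcases lt_or_ge b a with hb | hb
    · rw [h3 _ _ hb, zero_mul]
    · rw [hu _ _ (hac.trans_le hb), mul_zero]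
  · rw [mul_assoc]
    rfl

theorem InCell.mul_left {σ : Equiv.Perm (Fin (n + 1))}
    {M v : Matrix (Fin (n + 1)) (Fin (n + 1)) K} (h : InCell σ M)
    (hv : ∀ a c, a < c → v a c = 0) (hv' : ∀ a, v a a ≠ 0) : InCell σ (v * M) := by
  obtain ⟨L, U, h1, h2, h3, rfl⟩ := h
  refine ⟨v * L, U, fun a c hac => ?_, fun a => ?_, h3, (mul_assoc _ _ _).symm⟩
  · rw [Matrix.mul_apply]
    refine Finset.sum_eq_zero fun b _ => ?_
    rcases lt_or_ge a b with hb | hb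
    · rw [hv _ _ hb, zero_mul]
    · rw [h1 _ _ (hb.trans_lt hac), mul_zero]
  · rw [Matrix.mul_apply, Finset.sum_eq_single a]
    · exact mul_ne_zero (hv' a) (h2 a)
    · intro b _ hb
      rcases hb.lt_or_gt with hb | hb
      · rw [h1 _ _ hb, mul_zero]
      · rw [hv _ _ hb, zero_mul]
    · simp

theorem InCell.one : InCell (1 : Equiv.Perm (Fin (n + 1)))
    (1 : Matrix (Fin (n + 1)) (Fin (n + 1)) K) :=
  ⟨1, 1, fun _ _ h => one_apply_ne h.ne, fun a => by simp, fun _ _ h => one_apply_ne h.ne', by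
    ext a c
    simp⟩

/-- Multiplication with a suitable matrix `crossMatrix j x` swaps the entries at `j, j + 1` of
the permutation. -/
theorem InCell.exists_crossMatrix_mul_swap {σ : Equiv.Perm (Fin (n + 1))} {j : Fin n}
    {M : Matrix (Fin (n + 1)) (Fin (n + 1)) K}
    (h : InCell (σ * Equiv.swap j.castSucc j.succ) M) : ∃ x : K, InCell σ (crossMatrix j x * M) := by
  have hj : j.castSucc < j.succ := Fin.castSucc_lt_succ
  obtain ⟨L, U, h1, h2, h3, rfl⟩ := h
  -- This `x` makes the entry of `crossMatrix j x * L` at `(j, j)` vanish, so that exchanging the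
  -- columns `j` and `j + 1` restores a lower triangular matrix.
  refine ⟨- L j.succ j.castSucc / L j.castSucc j.castSucc,
    (crossMatrix j (- L j.succ j.castSucc / L j.castSucc j.castSucc) * L).submatrix id
      (Equiv.swap j.castSucc j.succ), U, ?_, ?_, h3, ?_⟩
  · intro a c hac
    have hd := h2 j.castSucc
    have key : ∀ b : Fin (n + 1), b < j.succ ↔ b ≤ j.castSucc := fun b => by
      simp [Fin.lt_def, Fin.le_def]
    have hs : L j.castSucc j.succ = 0 := h1 _ _ hj
    have hc : - L j.succ j.castSucc / L j.castSucc j.castSucc * L j.castSucc j.castSucc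
      = - L j.succ j.castSucc := by field_simp
    simp only [submatrix_apply, crossMatrix_mul_apply, id, Equiv.swap_apply_def]
    split_ifs <;> grind
  · intro a
    have hs : L j.castSucc j.succ = 0 := h1 _ _ hj
    simp only [submatrix_apply, crossMatrix_mul_apply, id, Equiv.swap_apply_def]
    split_ifs <;> grind
  · rw [← mul_assoc]
    have : U.submatrix (σ * Equiv.swap j.castSucc j.succ) id =
      (U.submatrix σ id).submatrix (Equiv.swap j.castSucc j.succ) id := rfl
    rw [this]
    generalize crossMatrix j (- L j.succ j.castSucc / L j.castSucc j.castSucc) * L = X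
    have h := submatrix_mul_equiv (X.submatrix id (Equiv.swap j.castSucc j.succ)) (U.submatrix σ id)
      id (Equiv.swap j.castSucc j.succ) id
    have hX : (X.submatrix id (Equiv.swap j.castSucc j.succ)).submatrix id
      (Equiv.swap j.castSucc j.succ) = X := by
      ext a c
      simp
    rw [hX, submatrix_id_id] at h
    exact h

/-- Multiplication with a suitable matrix `crossMatrix j x` preserves the cell of `σ` if the entries
at `j, j + 1` of `σ` are increasing. -/
theorem InCell.exists_crossMatrix_mul {σ : Equiv.Perm (Fin (n + 1))} {j : Fin n}
    {M : Matrix (Fin (n + 1)) (Fin (n + 1)) K} (h : InCell σ M)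
    (hσ : σ j.castSucc < σ j.succ) : ∃ x : K, InCell σ (crossMatrix j x * M) := by
  have hj : j.castSucc < j.succ := Fin.castSucc_lt_succ
  obtain ⟨L, U, h1, h2, h3, rfl⟩ := h
  set s : K := L j.succ j.succ with hs
  -- This `x` makes the entry of `crossMatrix j x * L` at `(j, j)` equal to one. A column operation
  -- then clears the entry `s` to its right. The inverse operation, carried through the permutation,
  -- acts on the rows `σ j < σ (j + 1)` of `U` and keeps `U` upper triangular.
  set x : K := (1 - L j.succ j.castSucc) / L j.castSucc j.castSucc with hx
  have hxp : x * L j.castSucc j.castSucc = 1 - L j.succ j.castSucc :=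
    div_mul_cancel₀ _ (h2 _)
  refine ⟨x, crossMatrix j x * L * transvection j.castSucc j.succ (-s),
    transvection (σ j.castSucc) (σ j.succ) s * U, ?_, ?_, ?_, ?_⟩
  · intro a c hac
    have key : ∀ b : Fin (n + 1), b < j.succ ↔ b ≤ j.castSucc := fun b => by
      simp [Fin.lt_def, Fin.le_def]
    have hs0 : L j.castSucc j.succ = 0 := h1 _ _ hj
    by_cases hc : c = j.succ
    · subst hc
      rw [mul_transvection_apply_same, crossMatrix_mul_apply, crossMatrix_mul_apply]
      split_ifs <;> grind
    · rw [mul_transvection_apply_of_ne _ _ _ _ hc, crossMatrix_mul_apply]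
      split_ifs <;> grind
  · intro a
    have hs0 : L j.castSucc j.succ = 0 := h1 _ _ hj
    have hd := h2 j.castSucc
    have hd' := h2 j.succ
    by_cases hc : a = j.succ
    · subst hc
      rw [mul_transvection_apply_same, crossMatrix_mul_apply, crossMatrix_mul_apply, if_neg hj.ne',
        if_pos rfl, if_neg hj.ne', if_pos rfl, hs0, zero_add]
      exact mul_ne_zero (neg_ne_zero.2 hd') hd
    · rw [mul_transvection_apply_of_ne _ _ _ _ hc, crossMatrix_mul_apply]
      split_ifs <;> grind
  · intro a c hac
    by_cases ha : a = σ j.castSucc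
    · subst ha
      rw [transvection_mul_apply_same, h3 _ _ hac, h3 _ _ (hac.trans hσ), mul_zero, add_zero]
    · rw [transvection_mul_apply_of_ne _ _ _ _ ha, h3 _ _ hac]
  · have hT : (transvection (σ j.castSucc) (σ j.succ) s * U).submatrix σ id =
        transvection j.castSucc j.succ s * U.submatrix σ id := by
      ext a c
      by_cases ha : a = j.castSucc
      · subst ha
        simp [transvection_mul_apply_same]
      · rw [transvection_mul_apply_of_ne _ _ _ _ ha, submatrix_apply,
          transvection_mul_apply_of_ne _ _ _ _ (fun h => ha (σ.injective h)), submatrix_apply]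
    rw [hT, mul_assoc _ (transvection _ _ _), ← mul_assoc (transvection _ _ _),
      transvection_mul_transvection_same _ _ hj.ne, neg_add_cancel, transvection_zero, one_mul,
      mul_assoc]

end Field

end BruhatCells

/-! ### Linear independence of monomials on opposite Bruhat cells -/

section Independence

open Matrix

/-- One step of sorting: the entries at `j, j + 1` are put into increasing order, unless
the comparison is skipped. -/
def sortStep {n : ℕ} (σ : Equiv.Perm (Fin (n + 1))) (p : Fin n × Bool) :
    Equiv.Perm (Fin (n + 1)) :=
  if p.2 = false ∧ σ p.1.succ < σ p.1.castSucc then σ * Equiv.swap p.1.castSucc p.1.succ else σ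

variable {K : Type*} [Field K] {n : ℕ}

/-- A single `x` is enough, because this is applied to polynomials that do not involve the new
coordinate. -/
theorem InCell.exists_of_sortStep {σ : Equiv.Perm (Fin (n + 1))} {j : Fin n}
    {M : Matrix (Fin (n + 1)) (Fin (n + 1)) K} (h : InCell (sortStep σ (j, false)) M) :
    ∃ x : K, InCell σ (crossMatrix j x * M) := by
  by_cases hσ : σ j.succ < σ j.castSucc
  · rw [sortStep, if_pos ⟨rfl, hσ⟩] at h
    exact h.exists_crossMatrix_mul_swap
  · rw [sortStep, if_neg (fun h => hσ h.2)] at h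
    exact h.exists_crossMatrix_mul (lt_of_le_of_ne (not_lt.1 hσ)
      (fun h => castSucc_ne_succ j (σ.injective h)))

/-- A point of a cell is the limit of points of the cell of a longer word, for which the new
coordinate tends to infinity. -/
theorem InCell.exists_curve {σ : Equiv.Perm (Fin (n + 1))} (j : Fin n) {l : ℕ} (q : Fin l → Fin n)
    (z : Fin l → K) (h : InCell σ (wordMatrix (List.ofFn fun i => (q i, z i)))) :
    ∃ p : Fin l → Polynomial K, (∀ i, (p i).eval 0 = z i) ∧ ∀ t : K, t ≠ 0 →
      InCell σ (wordMatrix ((j, t⁻¹) :: List.ofFn fun i => (q i, (p i).eval t))) := by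
  have hj : j.castSucc < j.succ := Fin.castSucc_lt_succ
  -- At `t = 0` this is the identity, so the curve starts at `z`.
  set u : Matrix (Fin (n + 1)) (Fin (n + 1)) (Polynomial K) :=
    transvection j.castSucc j.succ (-Polynomial.X) with hu
  have hU : IsUpperUnipotent u := by
    constructor
    · intro a c hac
      rw [hu, transvection, Matrix.add_apply, one_apply_ne hac.ne', single_apply, if_neg, add_zero]
      rintro ⟨rfl, rfl⟩
      exact hj.not_gt hac
    · intro a
      rw [hu, transvection, Matrix.add_apply, one_apply_eq, single_apply, if_neg, add_zero]
      rintro ⟨rfl, h⟩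
      exact hj.ne h.symm
  have hmap : ∀ t : K, u.map (Polynomial.evalRingHom t) = transvection j.castSucc j.succ (-t) := by
    intro t
    ext a c
    simp only [hu, transvection, map_apply, Matrix.add_apply, one_apply, single_apply, map_add]
    split_ifs <;> simp
  obtain ⟨p, u', hu', hp, hw⟩ := exists_wordMatrix_eq_mul (Polynomial.evalRingHom (0 : K)) q
    (fun i => Polynomial.C (z i)) u hU (by rw [hmap]; simp)
  refine ⟨p, fun i => by simpa using hp i, fun t ht => ?_⟩
  have hwt := congrArg (fun A : Matrix _ _ (Polynomial K) => A.map (Polynomial.evalRingHom t)) hw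
  simp only [Matrix.map_mul, map_wordMatrix, hmap, List.map_ofFn, Function.comp_def] at hwt
  simp only [Polynomial.coe_evalRingHom, Polynomial.eval_C] at hwt
  have hinv : IsUpperUnipotent (u'.map (Polynomial.evalRingHom t)) :=
    ⟨fun a c hac => by simp [hu'.1 a c hac], fun a => by simp [hu'.2 a]⟩
  set W := wordMatrix (List.ofFn fun i => (q i, (p i).eval t)) with hW
  set V := u'.map (Polynomial.evalRingHom t) with hV
  have hVtri : V.BlockTriangular id := fun a c hac => hinv.1 a c hac
  have hdet : IsUnit V.det := by
    rw [det_of_isUpperTriangular hVtri]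
    simp [hinv.2]
  have : Invertible V := V.invertibleOfIsUnitDet hdet
  have hVinv : V⁻¹.BlockTriangular id := blockTriangular_inv_of_blockTriangular hVtri
  have hWeq : W = transvection j.castSucc j.succ (-t) *
      (wordMatrix (List.ofFn fun i => (q i, z i)) * V⁻¹) := by
    rw [← mul_assoc, hwt]
    change W = W * V * V⁻¹
    rw [mul_assoc, mul_nonsing_inv _ hdet, mul_one]
  rw [wordMatrix_cons, ← hW, hWeq, ← mul_assoc]
  -- The block `[1/t, 1; 1, 0]` times `[1, -t; 0, 1]` is `[1/t, 0; 1, -t]`, which is lower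
  -- triangular and invertible.
  refine InCell.mul_left (h.mul_right fun a c hac => hVinv hac) ?_ ?_
  · intro a c hac
    have key : ∀ b : Fin (n + 1), b < j.succ ↔ b ≤ j.castSucc := fun b => by
      simp [Fin.lt_def, Fin.le_def]
    by_cases hc : c = j.succ
    · subst hc
      rw [mul_transvection_apply_same]
      simp only [crossMatrix, of_apply]
      split_ifs <;> grind
    · rw [mul_transvection_apply_of_ne _ _ _ _ hc]
      simp only [crossMatrix, of_apply]
      split_ifs <;> grind
  · intro a
    by_cases hc : a = j.succ
    · subst hc
      rw [mul_transvection_apply_same]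
      simp [crossMatrix, hj.ne', ht]
    · rw [mul_transvection_apply_of_ne _ _ _ _ hc]
      simp only [crossMatrix, of_apply]
      split_ifs <;> simp_all

/-- If a polynomial vanishes along a curve whose first coordinate tends to infinity, then
its leading coefficient with respect to this coordinate vanishes at the limit point. -/
theorem eval_coeff_natDegree_eq_zero_of_curve [Infinite K] {l : ℕ}
    (F : MvPolynomial (Fin (l + 1)) K) (z : Fin l → K) (p : Fin l → Polynomial K)
    (hp : ∀ i, (p i).eval 0 = z i)
    (h : ∀ t : K, t ≠ 0 → MvPolynomial.eval (Fin.cons t⁻¹ fun i => (p i).eval t) F = 0) :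
    MvPolynomial.eval z ((MvPolynomial.finSuccEquiv K l F).coeff
      (MvPolynomial.finSuccEquiv K l F).natDegree) = 0 := by
  set G := MvPolynomial.finSuccEquiv K l F with hG
  set e := G.natDegree with he
  have hev : ∀ (g : MvPolynomial (Fin l) K) (t : K),
      (MvPolynomial.aeval p g).eval t = MvPolynomial.eval (fun i => (p i).eval t) g := by
    intro g t
    induction g using MvPolynomial.induction_on <;> simp_all
  -- For `t ≠ 0` this is `t ^ e` times the value of `F` on the curve, hence zero. At `t = 0` only
  -- the leading coefficient survives.
  set H : Polynomial K := ∑ i ∈ Finset.range (e + 1),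
    Polynomial.X ^ (e - i) * MvPolynomial.aeval p (G.coeff i) with hH
  have hH0 : H = 0 := by
    refine Polynomial.eq_zero_of_infinite_isRoot H ?_
    refine (Set.Finite.infinite_compl (Set.finite_singleton (0 : K))).mono fun t ht => ?_
    have ht : t ≠ 0 := ht
    have h1 := h t ht
    rw [MvPolynomial.eval_eq_eval_mv_eval', ← hG, Polynomial.eval_map,
      Polynomial.eval₂_eq_sum_range] at h1
    have h2 : H.eval t = t ^ e * 0 := by
      rw [← h1, hH, Polynomial.eval_finsetSum, Finset.mul_sum]
      refine Finset.sum_congr rfl fun i hi => ?_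
      have hi : i ≤ e := Nat.lt_succ_iff.1 (Finset.mem_range.1 hi)
      rw [Polynomial.eval_mul, Polynomial.eval_pow, Polynomial.eval_X, hev, inv_pow,
        pow_sub₀ _ ht hi]
      ring
    simpa using h2
  have h0 : H.eval 0 = MvPolynomial.eval z (G.coeff e) := by
    rw [hH, Polynomial.eval_finsetSum, Finset.sum_eq_single e]
    · simp [hev, hp]
    · intro i hi hie
      have : e - i ≠ 0 := by
        have := Finset.mem_range.1 hi
        omega
      simp [this]
    · simp
  rw [← h0, hH0, Polynomial.eval_zero]

/-- A polynomial that vanishes on a cell is zero if for each of its monomials, skipping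
the comparisons at the variables of the monomial still sorts the permutation. -/
theorem eq_zero_of_vanishes_on_cell [Infinite K] {l : ℕ} (q : Fin l → Fin n)
    (σ : Equiv.Perm (Fin (n + 1))) (F : MvPolynomial (Fin l) K)
    (hF : ∀ m ∈ F.support,
      (List.ofFn fun i => (q i, m i != 0)).foldl sortStep σ = 1)
    (hv : ∀ z : Fin l → K, InCell σ (wordMatrix (List.ofFn fun i => (q i, z i))) →
      MvPolynomial.eval z F = 0) : F = 0 := by
  induction l generalizing σ with
  | zero =>
    by_contra hne
    obtain ⟨m, hm⟩ := MvPolynomial.support_nonempty.2 hne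
    have hσ : σ = 1 := by simpa using hF m hm
    have h0 := hv 0 (by simpa [hσ] using InCell.one)
    rw [MvPolynomial.eq_C_of_isEmpty F] at h0 hne
    simp only [MvPolynomial.eval_C] at h0
    simp [h0] at hne
  | succ l ih =>
    by_contra hne
    set G := MvPolynomial.finSuccEquiv K l F with hG
    have hG0 : G ≠ 0 := by simpa [hG] using hne
    have hlead : G.coeff G.natDegree ≠ 0 := by simpa using hG0
    have hsupp : ∀ m ∈ (G.coeff G.natDegree).support, m.cons G.natDegree ∈ F.support :=
      fun m hm => MvPolynomial.mem_support_coeff_finSuccEquiv.1 hm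
    -- In degree zero `F` is its own leading coefficient, and a point of the smaller cell lifts with
    -- a suitable first coordinate. In positive degree the first coordinate goes to infinity. The
    -- monomials of the leading coefficient extend to monomials of `F`, so the sorting hypothesis is
    -- inherited.
    rcases Nat.eq_zero_or_pos G.natDegree with he | he
    · refine hlead (ih (fun i => q i.succ) (sortStep σ (q 0, false)) _ ?_ ?_)
      · intro m hm
        have := hF _ (hsupp m hm)
        simp only [List.ofFn_succ, he, Finsupp.cons_zero, Finsupp.cons_succ] at this
        exact this
      · intro z hz
        obtain ⟨x, hx⟩ := hz.exists_of_sortStep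
        have h1 := hv (Fin.cons x z) (by simpa [List.ofFn_succ] using hx)
        rw [MvPolynomial.eval_eq_eval_mv_eval', ← hG, Polynomial.eq_C_of_natDegree_eq_zero he] at h1
        simpa [he] using h1
    · refine hlead (ih (fun i => q i.succ) σ _ ?_ ?_)
      · intro m hm
        have := hF _ (hsupp m hm)
        simp only [List.ofFn_succ, Finsupp.cons_zero, Finsupp.cons_succ, List.foldl_cons] at this
        rwa [sortStep, if_neg (by simp [he.ne'])] at this
      · intro z hz
        obtain ⟨p, hp, hcurve⟩ := hz.exists_curve (q 0)
        refine eval_coeff_natDegree_eq_zero_of_curve F z p hp fun t ht => ?_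
        exact hv _ (by simpa [List.ofFn_succ] using hcurve t ht)

end Independence

/-! ### The staircase word -/

section Staircase

open Matrix

/-- The first `d` letters of the row `a` of the staircase word, with their cells. -/
def rowWord (n a : ℕ) : ℕ → List (Fin n × (ℕ × ℕ))
  | 0 => []
  | d + 1 => rowWord n a d ++ if h : a + d < n then [(⟨a + d, h⟩, (a, n - d))] else []

/-- The letters of the last `s` rows of the staircase word, with their cells. -/
def stairWord (n : ℕ) : ℕ → List (Fin n × (ℕ × ℕ))
  | 0 => []
  | s + 1 => stairWord n s ++ rowWord n (n - (s + 1)) (s + 1)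

theorem mem_rowWord {n a d : ℕ} {p : Fin n × (ℕ × ℕ)} :
    p ∈ rowWord n a d ↔ ∃ i < d, a + i = p.1 ∧ p.2 = (a, n - i) := by
  induction d with
  | zero => simp [rowWord]
  | succ d ih =>
    rw [rowWord, List.mem_append, ih]
    constructor
    · rintro (⟨i, hi, h⟩ | h)
      · exact ⟨i, by omega, h⟩
      · split_ifs at h with h'
        · rw [List.mem_singleton] at h
          exact ⟨d, by omega, by simp [h], by simp [h]⟩
        · simp at h
    · rintro ⟨i, hi, h1, h2⟩
      rcases Nat.lt_succ_iff_lt_or_eq.1 hi with hi | rfl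
      · exact Or.inl ⟨i, hi, h1, h2⟩
      · right
        rw [dif_pos (by omega), List.mem_singleton]
        exact Prod.ext (Fin.ext h1.symm) h2

theorem exists_mem_stairWord {n s a b : ℕ} (hs : s ≤ n) (ha : n - s ≤ a) (hab : a < b)
    (hb : b ≤ n) : ∃ j, (j, (a, b)) ∈ stairWord n s := by
  induction s with
  | zero => omega
  | succ s ih =>
    by_cases h : n - s ≤ a
    · obtain ⟨j, hj⟩ := ih (by omega) h
      exact ⟨j, List.mem_append_left _ hj⟩
    · refine ⟨⟨a + (n - b), by omega⟩, List.mem_append_right _ (mem_rowWord.2 ⟨n - b, ?_, ?_, ?_⟩)⟩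
      · omega
      · simp only; omega
      · simp only [Prod.mk.injEq]; omega

theorem nodup_rowWord (n a d : ℕ) : ((rowWord n a d).map Prod.snd).Nodup := by
  induction d with
  | zero => simp [rowWord]
  | succ d ih =>
    rw [rowWord, List.map_append]
    split_ifs with h
    · refine List.Nodup.append ih (by simp) ?_
      intro x hx hx'
      obtain ⟨p, hp, rfl⟩ := List.mem_map.1 hx
      obtain ⟨i, hi, h1, h2⟩ := mem_rowWord.1 hp
      simp only [List.map_cons, List.map_nil, List.mem_singleton, h2, Prod.mk.injEq] at hx'
      have := p.1.2
      omega
    · simpa using ih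

theorem le_of_mem_stairWord {n s : ℕ} {p : Fin n × (ℕ × ℕ)} (h : p ∈ stairWord n s) :
    n - s ≤ p.2.1 := by
  induction s with
  | zero => simp [stairWord] at h
  | succ s ih =>
    rcases List.mem_append.1 h with h | h
    · have := ih h
      omega
    · obtain ⟨i, -, -, h2⟩ := mem_rowWord.1 h
      simp [h2]

theorem nodup_stairWord {n s : ℕ} (hs : s ≤ n) : ((stairWord n s).map Prod.snd).Nodup := by
  induction s with
  | zero => simp [stairWord]
  | succ s ih =>
    rw [stairWord, List.map_append]
    refine List.Nodup.append (ih (by omega)) (nodup_rowWord _ _ _) ?_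
    intro x hx hx'
    obtain ⟨p, hp, rfl⟩ := List.mem_map.1 hx
    obtain ⟨p', hp', h⟩ := List.mem_map.1 hx'
    obtain ⟨i, -, -, h2⟩ := mem_rowWord.1 hp'
    have := le_of_mem_stairWord hp
    rw [← h, h2] at this
    simp only at this
    omega

/-! ### The matrix of the staircase word -/

section Matrices

variable {R : Type*} [CommRing R] {n : ℕ}

/-- The letters carry column `a` to the right. Each column that it passes moves one place to the
left and receives a multiple of it. -/
theorem mul_wordMatrix_rowWord (M : Matrix (Fin (n + 1)) (Fin (n + 1)) R) (z : ℕ × ℕ → R)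
    {a d : ℕ} (had : a + d ≤ n) (x c : Fin (n + 1)) :
    (M * wordMatrix ((rowWord n a d).map fun p => (p.1, z p.2))) x c =
      if (c : ℕ) < a then M x c
      else if h : (c : ℕ) < a + d then
        z (a, n - (c - a)) * M x ⟨a, by omega⟩ + M x ⟨c + 1, by omega⟩
      else if (c : ℕ) = a + d then M x ⟨a, by omega⟩ else M x c := by
  induction d generalizing c with
  | zero =>
    simp only [rowWord, List.map_nil, wordMatrix_nil, mul_one]
    split_ifs with h1 h2 h3
    · rfl
    · omega
    · congr 1
      exact Fin.ext (by simpa using h3)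
    · rfl
  | succ d ih =>
    have ih := ih (by omega)
    rw [rowWord, dif_pos (by omega : a + d < n), List.map_append, wordMatrix_append, ← mul_assoc]
    simp only [List.map_cons, List.map_nil, wordMatrix_cons, wordMatrix_nil, mul_one]
    rw [mul_crossMatrix_apply, ih, ih, ih]
    simp only [Fin.ext_iff, Fin.castSucc_mk, Fin.succ_mk]
    by_cases h1 : (c : ℕ) = a + d
    · simp only [h1]
      simp
    · by_cases h2 : (c : ℕ) = a + d + 1
      · simp [h2, add_assoc]
      · simp only [h1, h2, if_false]
        split_ifs <;> first | rfl | omega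

/-- The entries of the matrix of the staircase word above the antidiagonal are the parameters. -/
theorem wordMatrix_stairWord (z : ℕ × ℕ → R) {s : ℕ} (hs : s ≤ n) (x c : Fin (n + 1)) :
    ((x : ℕ) < n - s → wordMatrix ((stairWord n s).map fun p => (p.1, z p.2)) x c =
      if x = c then 1 else 0) ∧
    (n - s ≤ (x : ℕ) → (c : ℕ) < n - s →
      wordMatrix ((stairWord n s).map fun p => (p.1, z p.2)) x c = 0) ∧
    (n - s ≤ (x : ℕ) → n - s ≤ (c : ℕ) → (x : ℕ) + c < n - s + n →
      wordMatrix ((stairWord n s).map fun p => (p.1, z p.2)) x c = z (x, n - (c - (n - s)))) := by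
  induction s generalizing c with
  | zero =>
    simp only [stairWord, List.map_nil, wordMatrix_nil]
    refine ⟨fun _ => by rw [one_apply], fun h1 h2 => one_apply_ne ?_, fun h1 h2 h3 => ?_⟩
    · rintro rfl; omega
    · omega
  | succ s ih =>
    have ih := fun c => ih (by omega) c
    have hM := fun c => mul_wordMatrix_rowWord
      (wordMatrix ((stairWord n s).map fun p => (p.1, z p.2))) z
      (show n - (s + 1) + (s + 1) ≤ n by omega) x c
    rw [stairWord, List.map_append, wordMatrix_append, hM]
    refine ⟨fun h => ?_, fun h1 h2 => ?_, fun h1 h2 h3 => ?_⟩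
    · rw [(ih _).1 (by omega), (ih _).1 (by omega)]
      simp only [Fin.ext_iff]
      split_ifs <;> first
        | rfl
        | omega
        | (rw [(ih _).1 (by omega), if_neg (by rw [Fin.ext_iff]; simp only; omega)]; simp)
    · rw [if_pos h2]
      rcases Nat.lt_or_ge (x : ℕ) (n - s) with h | h
      · rw [(ih c).1 h, if_neg]
        rintro rfl; omega
      · exact (ih c).2.1 h (by omega)
    -- Row `n - (s + 1)` was a unit vector, so the new row shows the parameters. In the rows below,
    -- column `n - (s + 1)` was zero, so the old entries only move one column to the left.
    · rw [if_neg (by omega), dif_pos (by omega)]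
      rcases Nat.lt_or_ge (x : ℕ) (n - s) with h | h
      · have hx : (x : ℕ) = n - (s + 1) := by omega
        rw [(ih _).1 h, (ih _).1 h, if_pos (Fin.ext hx), if_neg, mul_one, add_zero, hx]
        intro h; simp only [Fin.ext_iff] at h; omega
      · rw [(ih ⟨n - (s + 1), _⟩).2.1 h (by simp only; omega),
          (ih ⟨c + 1, _⟩).2.2 h (by simp only; omega) (by simp only; omega), mul_zero, zero_add]
        congr 2
        simp only
        omega

end Matrices

/-- The permutation that fixes the first and the last `r - 1` elements and reverses the
other ones. -/
def middleRev (n r : ℕ) : Equiv.Perm (Fin (n + 1)) :=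
  Function.Involutive.toPerm
    (fun x => if r ≤ (x : ℕ) + 1 ∧ (x : ℕ) + r ≤ n + 1 then Fin.rev x else x) (by
      intro x
      by_cases h : r ≤ (x : ℕ) + 1 ∧ (x : ℕ) + r ≤ n + 1
      · have h' : r ≤ (Fin.rev x : ℕ) + 1 ∧ (Fin.rev x : ℕ) + r ≤ n + 1 := by
          rw [Fin.val_rev]; omega
        simp only [h, and_self, if_true, h', Fin.rev_rev]
      · simp only [h, if_false])

theorem middleRev_val (n r : ℕ) (x : Fin (n + 1)) : (middleRev n r x : ℕ) =
    if r ≤ (x : ℕ) + 1 ∧ (x : ℕ) + r ≤ n + 1 then n - x else x := by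
  change ((if r ≤ (x : ℕ) + 1 ∧ (x : ℕ) + r ≤ n + 1 then Fin.rev x else x : Fin (n + 1)) : ℕ) = _
  split_ifs
  · rw [Fin.val_rev]; omega
  · rfl

/-- On the cell of `middleRev n r`, the minors of size `r` above the antidiagonal vanish. -/
theorem InCell.det_submatrix_eq_zero {K : Type*} [Field K] {n r : ℕ} (hr : 1 ≤ r)
    (hn : 2 * r ≤ n + 1) {M : Matrix (Fin (n + 1)) (Fin (n + 1)) K}
    (h : InCell (middleRev n r) M) (f g : Fin r → Fin (n + 1))
    (hfg : ∀ i j, (f i : ℕ) + g j < n) : (M.submatrix f g).det = 0 := by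
  obtain ⟨L, U, h1, -, h3, rfl⟩ := h
  -- Only the first `r - 1` inner indices contribute. A nonzero term at `x` needs `x ≤ f i` and `σ x
  -- ≤ g j`. For `x` in the reversed range this gives `n ≤ f i + g j`; for larger `x` it gives `2 *
  -- x ≤ f i + g j`, and `2 * r ≤ n + 1` excludes this.
  have hfac : (L * U.submatrix (middleRev n r) id).submatrix f g =
      (L.submatrix f (Fin.castLE (by omega : r - 1 ≤ n + 1))) *
      ((U.submatrix (middleRev n r) id).submatrix (Fin.castLE (by omega : r - 1 ≤ n + 1)) g) := by
    ext i j
    rw [submatrix_apply, Matrix.mul_apply, Matrix.mul_apply]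
    symm
    refine Finset.sum_of_injOn (Fin.castLE (by omega : r - 1 ≤ n + 1))
      (Fin.castLE_injective _).injOn (by simp) ?_ (fun _ _ => rfl)
    intro x _ hx
    simp only [Finset.coe_univ, Set.image_univ, Fin.range_castLE, Set.mem_ofPred_eq, not_lt] at hx
    rcases Nat.lt_or_ge (f i) x with hfx | hfx
    · rw [h1 _ _ hfx, zero_mul]
    · rw [submatrix_apply, h3 _ _, mul_zero]
      rw [Fin.lt_def, middleRev_val]
      have := hfg i j
      simp only [id]
      split_ifs <;> omega
  by_contra hdet
  have hrank := rank_of_isUnit _ ((isUnit_iff_isUnit_det _).2 (isUnit_iff_ne_zero.2 hdet))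
  rw [hfac, Fintype.card_fin] at hrank
  have hle := (rank_mul_le_left (L.submatrix f (Fin.castLE (by omega : r - 1 ≤ n + 1)))
    ((U.submatrix (middleRev n r) id).submatrix (Fin.castLE (by omega : r - 1 ≤ n + 1)) g)).trans
    (rank_le_width _)
  omega

end Staircase

/-! ### Sorting along the staircase word -/

section Sorting

variable {n : ℕ}

/-- The number of values less than `θ` among the first `p` entries of a permutation. -/
def smallCount (σ : Equiv.Perm (Fin (n + 1))) (θ p : ℕ) : ℕ :=
  (Finset.univ.filter fun x : Fin (n + 1) => (x : ℕ) < p ∧ (σ x : ℕ) < θ).card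

theorem smallCount_succ (σ : Equiv.Perm (Fin (n + 1))) (θ : ℕ) (x : Fin (n + 1)) :
    smallCount σ θ (x + 1) = smallCount σ θ x + if (σ x : ℕ) < θ then 1 else 0 := by
  unfold smallCount
  split_ifs with h
  · have : (Finset.univ.filter fun y : Fin (n + 1) => (y : ℕ) < x + 1 ∧ (σ y : ℕ) < θ) =
        insert x (Finset.univ.filter fun y : Fin (n + 1) => (y : ℕ) < x ∧ (σ y : ℕ) < θ) := by
      ext y
      simp only [Finset.mem_filter_univ, Finset.mem_insert, Nat.lt_succ_iff_lt_or_eq,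
        ← Fin.ext_iff]
      grind
    rw [this, Finset.card_insert_of_notMem (by simp)]
  · rw [add_zero]
    congr 1
    ext y
    simp only [Finset.mem_filter_univ, Nat.lt_succ_iff_lt_or_eq, ← Fin.ext_iff]
    grind

theorem smallCount_mono (σ : Equiv.Perm (Fin (n + 1))) (θ : ℕ) : Monotone (smallCount σ θ) := by
  intro p p' h
  refine Finset.card_le_card fun x => ?_
  simp only [Finset.mem_filter_univ]
  exact fun hx => ⟨hx.1.trans_le h, hx.2⟩

theorem smallCount_swap (σ : Equiv.Perm (Fin (n + 1))) (θ : ℕ) (j : Fin n) {p : ℕ}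
    (hp : p ≠ j + 1) :
    smallCount (σ * Equiv.swap j.castSucc j.succ) θ p = smallCount σ θ p := by
  refine Finset.card_equiv (Equiv.swap j.castSucc j.succ) fun x => ?_
  rw [Finset.mem_filter_univ, Finset.mem_filter_univ, Equiv.Perm.mul_apply]
  refine and_congr_left fun _ => ?_
  rw [Equiv.swap_apply_def]
  split_ifs with h1 h2
  · subst h1
    simp only [Fin.val_castSucc, Fin.val_succ]; omega
  · subst h2
    simp only [Fin.val_castSucc, Fin.val_succ]; omega
  · rfl

theorem smallCount_sortStep_of_ne (σ : Equiv.Perm (Fin (n + 1))) (θ : ℕ) (b : Bool) (j : Fin n)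
    {p : ℕ} (hp : p ≠ j + 1) : smallCount (sortStep σ (j, b)) θ p = smallCount σ θ p := by
  unfold sortStep
  split_ifs
  · exact smallCount_swap σ θ j hp
  · rfl

theorem smallCount_sortStep_true (σ : Equiv.Perm (Fin (n + 1))) (θ : ℕ) (j : Fin n)
    (p : ℕ) : smallCount (sortStep σ (j, true)) θ p = smallCount σ θ p := by
  simp [sortStep]

/-- After the comparison, the entry at `j` is small as soon as one of the two compared entries is.
-/
theorem smallCount_sortStep_false (σ : Equiv.Perm (Fin (n + 1))) (θ : ℕ) (j : Fin n) :
    smallCount (sortStep σ (j, false)) θ (j + 1) =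
      min (smallCount σ θ j + 1) (smallCount σ θ (j + 2)) := by
  have h1 := smallCount_succ σ θ j.castSucc
  have h2 := smallCount_succ σ θ j.succ
  simp only [Fin.val_castSucc, Fin.val_succ] at h1 h2
  unfold sortStep
  split_ifs with h
  · have h3 := smallCount_succ (σ * Equiv.swap j.castSucc j.succ) θ j.castSucc
    rw [Equiv.Perm.mul_apply, Equiv.swap_apply_left] at h3
    simp only [Fin.val_castSucc] at h3
    rw [smallCount_swap σ θ j (p := j) (by omega)] at h3
    have hlt := Fin.lt_def.1 h.2
    simp only at hlt
    rw [h3, h2, h1]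
    split_ifs <;> omega
  · have hlt : (σ j.castSucc : ℕ) ≤ σ j.succ := by
      simpa using h
    rw [h2, h1]
    split_ifs <;> omega

theorem smallCount_succ_le (σ : Equiv.Perm (Fin (n + 1))) (θ p : ℕ) :
    smallCount σ θ (p + 1) ≤ smallCount σ θ p + 1 := by
  by_cases hp : p < n + 1
  · have := smallCount_succ σ θ ⟨p, hp⟩
    simp only at this
    rw [this]
    split_ifs <;> omega
  · refine le_trans (Finset.card_le_card fun x => ?_) (Nat.le_succ _)
    simp only [Finset.mem_filter_univ]
    exact fun hx => ⟨by omega, hx.2⟩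

theorem smallCount_le_sortStep (σ : Equiv.Perm (Fin (n + 1))) (θ p : ℕ) (x : Fin n × Bool) :
    smallCount σ θ p ≤ smallCount (sortStep σ x) θ p := by
  obtain ⟨j, b⟩ := x
  by_cases hp : p = j + 1
  · subst hp
    cases b
    · rw [smallCount_sortStep_false]
      exact le_min (smallCount_succ_le _ _ _) (smallCount_mono _ _ (by omega))
    · rw [smallCount_sortStep_true]
  · rw [smallCount_sortStep_of_ne _ _ _ _ hp]

theorem smallCount_le_foldl (L : List (Fin n × Bool)) (σ : Equiv.Perm (Fin (n + 1))) (θ p : ℕ) :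
    smallCount σ θ p ≤ smallCount (L.foldl sortStep σ) θ p := by
  induction L generalizing σ with
  | nil => rfl
  | cons x L ih => exact (smallCount_le_sortStep σ θ p x).trans (ih _)

theorem smallCount_all (σ : Equiv.Perm (Fin (n + 1))) {θ : ℕ} (hθ : θ ≤ n + 1) :
    θ ≤ smallCount σ θ (n + 1) := by
  refine Finset.le_card_of_inj_on_range (fun i => if h : i < n + 1 then σ.symm ⟨i, h⟩ else 0)
    ?_ ?_
  · intro i hi
    rw [dif_pos (by omega)]
    simp only [Finset.mem_filter_univ, Equiv.apply_symm_apply]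
    exact ⟨Fin.isLt _, hi⟩
  · intro i hi j hj h
    rw [dif_pos (by omega), dif_pos (by omega)] at h
    simpa using h

/-- The hypothesis forces `σ x ≤ x` for all `x`, and both sides have the same sum. -/
theorem eq_one_of_le_smallCount (σ : Equiv.Perm (Fin (n + 1)))
    (h : ∀ θ ≤ n + 1, θ ≤ smallCount σ θ θ) : σ = 1 := by
  have key : ∀ x : Fin (n + 1), σ x ≤ x := by
    intro x
    have h1 := h (x + 1) x.2
    have hsub : (Finset.univ.filter fun y : Fin (n + 1) => (y : ℕ) < x + 1 ∧ (σ y : ℕ) < x + 1) ⊆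
        Finset.univ.filter fun y : Fin (n + 1) => (y : ℕ) < x + 1 := by
      intro y
      simp only [Finset.mem_filter_univ]
      exact And.left
    have hcard : (Finset.univ.filter fun y : Fin (n + 1) => (y : ℕ) < x + 1).card ≤ x + 1 := by
      have : (Finset.univ.filter fun y : Fin (n + 1) => (y : ℕ) < x + 1) = Finset.Iic x := by
        ext y
        simp only [Finset.mem_filter_univ, Finset.mem_Iic, Fin.le_def]
        omega
      rw [this, Fin.card_Iic]
    have heq := Finset.eq_of_subset_of_card_le hsub (hcard.trans h1)
    have hx : x ∈ Finset.univ.filter fun y : Fin (n + 1) => (y : ℕ) < x + 1 := by simp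
    rw [← heq] at hx
    simp only [Finset.mem_filter_univ] at hx
    exact Fin.le_def.2 (by omega)
  have hsum : ∑ x, ((σ x : Fin (n + 1)) : ℕ) = ∑ x : Fin (n + 1), (x : ℕ) :=
    Equiv.sum_comp σ fun x : Fin (n + 1) => (x : ℕ)
  have := (Finset.sum_eq_sum_iff_of_le fun x _ => Fin.le_def.1 (key x)).1 hsum
  ext x
  simpa using this x (Finset.mem_univ x)

/-- The values of `smallCount` after sorting along (part of) a row. -/
theorem smallCount_foldl_rowWord (σ : Equiv.Perm (Fin (n + 1))) (θ : ℕ) (used : ℕ × ℕ → Bool)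
    {a d : ℕ} (had : a + d ≤ n) :
    (∀ p, p ≤ a ∨ a + d < p → smallCount
      (((rowWord n a d).map fun p => (p.1, used p.2)).foldl sortStep σ) θ p = smallCount σ θ p) ∧
    ∀ i < d, used (a, n - i) = false →
      smallCount (((rowWord n a d).map fun p => (p.1, used p.2)).foldl sortStep σ) θ (a + i + 1) =
        min (smallCount (((rowWord n a d).map fun p => (p.1, used p.2)).foldl sortStep σ) θ (a + i)
          + 1) (smallCount σ θ (a + i + 2)) := by
  induction d with
  | zero => exact ⟨fun p _ => by simp [rowWord], fun i hi => by omega⟩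
  | succ d ih =>
    obtain ⟨h1, h2⟩ := ih (by omega)
    rw [rowWord, dif_pos (by omega : a + d < n), List.map_append, List.foldl_append]
    simp only [List.map_cons, List.map_nil, List.foldl_cons, List.foldl_nil]
    set τ := ((rowWord n a d).map fun p => (p.1, used p.2)).foldl sortStep σ
    have hne : ∀ p, p ≠ a + d + 1 → smallCount
        (sortStep τ ((⟨a + d, by omega⟩ : Fin n), used (a, n - d))) θ p = smallCount τ θ p :=
      fun p hp => smallCount_sortStep_of_ne _ _ _ _ hp
    -- The letter `a + i` only affects the prefix of length `a + i + 1`. When it acts, the prefix of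
    -- length `a + i` has its final count and the one of length `a + i + 2` still has its initial
    -- count.
    refine ⟨fun p hp => ?_, fun i hi hu => ?_⟩
    · rw [hne p (by omega), h1 p (by omega)]
    · rcases Nat.lt_succ_iff_lt_or_eq.1 hi with hi | rfl
      · rw [hne _ (by omega), hne _ (by omega), h2 i hi hu]
      · rw [hne (a + i) (by omega), hu]
        have := smallCount_sortStep_false τ θ (⟨a + i, by omega⟩ : Fin n)
        simp only at this
        rw [this, h1 (a + i + 2) (by omega)]

/-- The permutation that is obtained from `middleRev n r` by sorting along the last `s` rows of the
staircase, where the comparisons at the cells in `used` are skipped. -/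
def sortedBy (n r : ℕ) (used : ℕ × ℕ → Bool) (s : ℕ) : Equiv.Perm (Fin (n + 1)) :=
  ((stairWord n s).map fun p => (p.1, used p.2)).foldl sortStep (middleRev n r)

/-- For such `θ` the set of the first `θ` elements is stable: it is fixed pointwise or contains the
whole reversed range. -/
theorem smallCount_middleRev_of_lt {r θ : ℕ} (hθ : θ ≤ n + 1) (h : θ < r ∨ n + 1 < θ + r) :
    θ ≤ smallCount (middleRev n r) θ θ := by
  refine Finset.le_card_of_inj_on_range (fun i => if h : i < n + 1 then ⟨i, h⟩ else 0) ?_ ?_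
  · intro i hi
    rw [dif_pos (by omega)]
    simp only [Finset.mem_filter_univ, middleRev_val]
    refine ⟨hi, ?_⟩
    split_ifs <;> omega
  · intro i hi j hj h
    rw [dif_pos (by omega), dif_pos (by omega)] at h
    simpa using h

theorem le_smallCount_middleRev {r θ k e : ℕ} (hr : 1 ≤ r) (hrθ : r ≤ θ) (hθ : θ + r ≤ n + 1)
    (hk : k ≤ θ) (he : k < r ∨ n + 2 ≤ e + θ + r) : k ≤ smallCount (middleRev n r) θ (k + e) := by
  -- The positions of the small values, counted from `i = 0`: the first `r - 1` are at `i`, the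
  -- others start at `n + 1 - θ` and are consecutive. The value `0` is never reached.
  refine Finset.le_card_of_inj_on_range
    (fun i => if h : n + 2 + i - θ - r < n + 1 then if i + 1 < r then ⟨i, by omega⟩
      else ⟨n + 2 + i - θ - r, h⟩ else 0) ?_ ?_
  · intro i hi
    rw [dif_pos (by omega)]
    simp only [Finset.mem_filter_univ, middleRev_val]
    split_ifs <;> simp only at * <;> omega
  · intro i hi j hj h
    rw [dif_pos (by omega), dif_pos (by omega)] at h
    split_ifs at h <;> simp only [Fin.mk.injEq] at h <;> omega

/-- If the `k`-th small value is too far to the right after sorting along the last rows, then the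
skipped cells in these rows contain a long diagonal. -/
theorem exists_diagonal_of_smallCount_lt {r θ : ℕ} (hr : 1 ≤ r) (hrθ : r ≤ θ) (hθ : θ + r ≤ n + 1)
    (used : ℕ × ℕ → Bool) {s : ℕ} (hs : s ≤ n) (k t e : ℕ) (hte : n - s + t = r + e) (hk : k ≤ θ)
    (h : smallCount (sortedBy n r used s) θ (k + e) < k) :
    ∃ α β : Fin t → ℕ, StrictMono α ∧ StrictMono β ∧ ∀ i, used (α i, β i) = true ∧
      n - s ≤ α i ∧ α i + θ ≤ n ∧ n + 1 + r ≤ β i + k + t := by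
  -- Here `e` is the tolerated delay and `t` the length of the diagonal still to be found. Undoing a
  -- row raises `n - s` by one, so either `e` grows or `t` drops by one.
  induction s generalizing k t e with
  | zero =>
    have h0 : ¬ (k < r ∨ n + 2 ≤ e + θ + r) := fun h' =>
      h.not_ge (le_smallCount_middleRev hr hrθ hθ hk h')
    -- Before any sorting, lateness forces `e + θ + r ≤ n + 1`, which leaves no room for a positive
    -- `t`.
    have ht : t = 0 := by omega
    subst ht
    exact ⟨Fin.elim0, Fin.elim0, fun i => i.elim0, fun i => i.elim0, fun i => i.elim0⟩
  | succ s ih =>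
    have hτ : sortedBy n r used (s + 1) =
        ((rowWord n (n - (s + 1)) (s + 1)).map fun p => (p.1, used p.2)).foldl sortStep
          (sortedBy n r used s) := by
      rw [sortedBy, stairWord, List.map_append, List.foldl_append]
      rfl
    obtain ⟨-, hrec⟩ := smallCount_foldl_rowWord (sortedBy n r used s) θ used
      (show n - (s + 1) + (s + 1) ≤ n by omega)
    rw [← hτ] at hrec
    have hle : ∀ p, smallCount (sortedBy n r used s) θ p ≤
        smallCount (sortedBy n r used (s + 1)) θ p := fun p => by
      rw [hτ]
      exact smallCount_le_foldl _ _ _ _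
    have hle0 : ∀ p, smallCount (middleRev n r) θ p ≤
        smallCount (sortedBy n r used (s + 1)) θ p := fun p => smallCount_le_foldl _ _ _ _
    induction k generalizing e t with
    | zero => omega
    | succ k ihk =>
      have h0 : ¬ (k + 1 < r ∨ n + 2 ≤ e + θ + r) := fun h' =>
        h.not_ge ((le_smallCount_middleRev hr hrθ hθ hk h').trans (hle0 _))
      rcases Nat.eq_zero_or_pos t with rfl | ht
      · exact ⟨Fin.elim0, Fin.elim0, fun i => i.elim0, fun i => i.elim0, fun i => i.elim0⟩
      -- First case: before this row the value was late by one more place, and the row contributes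
      -- no cell.
      by_cases h1 : smallCount (sortedBy n r used s) θ (k + 1 + (e + 1)) < k + 1
      · obtain ⟨α, β, hα, hβ, hαβ⟩ := ih (by omega) (k + 1) t (e + 1) (by omega) hk h1
        exact ⟨α, β, hα, hβ, fun i => ⟨(hαβ i).1, by have := (hαβ i).2.1; omega, (hαβ i).2.2⟩⟩
      have hP : k + 1 + e < n + 1 := by
        by_contra hcon
        have h2 := smallCount_mono (sortedBy n r used (s + 1)) θ (not_lt.1 hcon)
        have h3 := smallCount_all (sortedBy n r used (s + 1)) (show θ ≤ n + 1 by omega)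
        omega
      obtain ⟨t, rfl⟩ : ∃ t', t = t' + 1 := ⟨t - 1, by omega⟩
      have hi : n - (s + 1) + (k + t + 1 - r) + 1 = k + 1 + e := by omega
      -- The cell of the comparison at the positions `k + e` and `k + e + 1`. If it was skipped, it
      -- is put in front of a diagonal found in the later rows; the bounds on `α` and `β` place it
      -- strictly before them.
      by_cases hu : used (n - (s + 1), n - (k + t + 1 - r)) = true
      · obtain ⟨α, β, hα, hβ, hαβ⟩ := ih (by omega) (k + 1) t e (by omega) hk
          ((hle _).trans_lt h)
        refine ⟨Fin.cons (n - (s + 1)) α, Fin.cons (n - (k + t + 1 - r)) β, ?_, ?_, ?_⟩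
        · refine Fin.strictMono_cons.2 ⟨fun i => ?_, hα⟩
          have := (hαβ i).2.1
          omega
        · refine Fin.strictMono_cons.2 ⟨fun i => ?_, hβ⟩
          have := (hαβ i).2.2.2
          omega
        · refine Fin.cases ⟨by simpa using hu, ?_⟩ fun i => ?_
          · simp only [Fin.cons_zero]
            omega
          · have := hαβ i
            simp only [Fin.cons_succ]
            exact ⟨this.1, by omega, by omega, by omega⟩
      -- The comparison was made, so the value can be late only because the preceding small value is
      -- late with the same delay. This is the induction on `k`.
      · have hr' := hrec (k + t + 1 - r) (by omega) (by simpa using hu)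
        rw [hi, show n - (s + 1) + (k + t + 1 - r) + 2 = k + 1 + (e + 1) by omega,
          show n - (s + 1) + (k + t + 1 - r) = k + e by omega] at hr'
        rw [hr', min_lt_iff] at h
        obtain ⟨α, β, hα, hβ, hαβ⟩ := ihk (t + 1) e (by omega) (by omega)
          (by omega)
        exact ⟨α, β, hα, hβ, fun i => ⟨(hαβ i).1, (hαβ i).2.1, (hαβ i).2.2.1,
          by have := (hαβ i).2.2.2; omega⟩⟩

/-- If the skipped cells contain no `r`-crossing, then the permutation is sorted. -/
theorem sortedBy_eq_one {r : ℕ} (hr : 1 ≤ r) (used : ℕ × ℕ → Bool)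
    (h : ¬ ∃ α β : Fin r → ℕ, StrictMono α ∧ StrictMono β ∧ (∀ i, used (α i, β i) = true) ∧
      ∀ i j, α i < β j) : sortedBy n r used n = 1 := by
  refine eq_one_of_le_smallCount _ fun θ hθ => ?_
  by_cases hrθ : r ≤ θ ∧ θ + r ≤ n + 1
  · by_contra hlt
    -- For `k = θ`, `t = r` and `e = 0` the bounds become `α i ≤ n - θ < β j`, which is the crossing
    -- condition.
    obtain ⟨α, β, hα, hβ, hαβ⟩ := exists_diagonal_of_smallCount_lt hr hrθ.1 hrθ.2 used le_rfl θ r 0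
      (by omega) le_rfl (not_le.1 hlt)
    refine h ⟨α, β, hα, hβ, fun i => (hαβ i).1, fun i j => ?_⟩
    have h1 := (hαβ i).2.2.1
    have h2 := (hαβ j).2.2.2
    omega
  · exact (smallCount_middleRev_of_lt hθ (by omega)).trans (smallCount_le_foldl _ _ _ _)

end Sorting

/-! ### Crossing-free monomials are independent modulo minors -/

section CrossingFree

open Matrix

theorem ofFn_get_eq_map {A B T : Type*} (Q : List (A × B)) (y : Fin Q.length → T) (x : B → T)
    (hxy : ∀ i, x (Q.get i).2 = y i) :
    (List.ofFn fun i => ((Q.get i).1, y i)) = Q.map fun p => (p.1, x p.2) := by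
  conv_rhs => rw [← List.ofFn_get Q, List.map_ofFn]
  congr 1
  funext i
  simp only [Function.comp_apply, hxy]

/-- A polynomial in the entries of a triangular array is zero if its monomials are free of
`r`-crossings and if it vanishes on all arrays with vanishing `r`-minors. -/
theorem eq_zero_of_vanishes_of_minors {K V : Type*} [Field K] [Infinite K] {n r : ℕ} (hr : 1 ≤ r)
    (hn : 2 * r ≤ n + 1) (ι : V → ℕ × ℕ) (hinj : Function.Injective ι)
    (hι : ∀ v, (ι v).1 < (ι v).2 ∧ (ι v).2 ≤ n) (F : MvPolynomial V K)
    (hF : ∀ m ∈ F.support, ¬ ∃ α β : Fin r → ℕ, StrictMono α ∧ StrictMono β ∧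
      (∀ i, ∃ v ∈ m.support, ι v = (α i, β i)) ∧ ∀ i j, α i < β j)
    (hv : ∀ x : ℕ × ℕ → K, (∀ f g : Fin r → ℕ, (∀ i j, f i < g j ∧ g j ≤ n) →
      (Matrix.of fun i j => x (f i, g j)).det = 0) →
      MvPolynomial.eval (fun v => x (ι v)) F = 0) : F = 0 := by
  classical
  set Q := stairWord n n with hQ
  have hnodup : Function.Injective fun i : Fin Q.length => (Q.get i).2 := by
    have h := List.nodup_iff_injective_get.1 (nodup_stairWord (le_refl n))
    intro i j hij
    have h' := @h (i.cast (by simp [hQ])) (j.cast (by simp [hQ])) (by simpa using hij)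
    exact Fin.ext (by simpa using congrArg Fin.val h')
  have hJ : ∀ v, ∃ i : Fin Q.length, (Q.get i).2 = ι v := by
    intro v
    obtain ⟨j, hj⟩ := exists_mem_stairWord (le_refl n) (by omega) (hι v).1 (hι v).2
    obtain ⟨i, hi⟩ := List.mem_iff_get.1 hj
    exact ⟨i, by rw [hi]⟩
  choose J hJ using hJ
  have hJinj : Function.Injective J := fun v w h => hinj (by rw [← hJ, ← hJ, h])
  refine (MvPolynomial.rename_injective J hJinj) ?_
  rw [map_zero]
  refine eq_zero_of_vanishes_on_cell (fun i => (Q.get i).1) (middleRev n r) _ ?_ ?_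
  · intro m' hm'
    rw [MvPolynomial.support_rename_of_injective hJinj, Finset.mem_image] at hm'
    obtain ⟨m, hm, rfl⟩ := hm'
    have hs := sortedBy_eq_one (n := n) hr (fun p => decide (∃ v ∈ m.support, ι v = p))
      (by simpa using hF m hm)
    rw [sortedBy, ← hQ] at hs
    rw [ofFn_get_eq_map Q _ (fun p => decide (∃ v ∈ m.support, ι v = p)), hs]
    intro i
    rw [Bool.eq_iff_iff, decide_eq_true_iff, bne_iff_ne]
    constructor
    · rintro ⟨v, hv, h⟩
      have : J v = i := hnodup (by simp only [hJ, h])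
      rw [← this, Finsupp.mapDomain_apply hJinj]
      exact Finsupp.mem_support_iff.1 hv
    · intro h
      have hi : i ∈ Set.range J := by
        by_contra hi
        exact h (Finsupp.mapDomain_of_notMem_range _ _ hi)
      obtain ⟨v, rfl⟩ := hi
      rw [Finsupp.mapDomain_apply hJinj] at h
      exact ⟨v, Finsupp.mem_support_iff.2 h, (hJ v).symm⟩
  · intro z hz
    -- The cells of the word are distinct, so the parameters define an array; the value `0`
    -- elsewhere plays no role.
    set x : ℕ × ℕ → K := Function.extend (fun i : Fin Q.length => (Q.get i).2) z 0 with hx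
    have hxz : ∀ i, x (Q.get i).2 = z i := fun i => hnodup.extend_apply z 0 i
    rw [ofFn_get_eq_map Q z x hxz] at hz
    rw [MvPolynomial.eval_rename]
    have hzJ : z ∘ J = fun v => x (ι v) := by
      funext v
      rw [← hJ v, hxz, Function.comp_apply]
    rw [hzJ]
    refine hv x fun f g hfg => ?_
    have hlt : ∀ i, f i < n + 1 := fun i => by
      have := hfg i i
      omega
    -- Column `g j` of the array is column `n - g j` of the matrix, so `f i < g j` puts the entry
    -- above the antidiagonal.
    rw [← hz.det_submatrix_eq_zero hr hn (fun i => ⟨f i, hlt i⟩) (fun j => ⟨n - g j, by omega⟩)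
      (fun i j => by have := hfg i j; simp only; omega)]
    congr 1
    ext i j
    rw [submatrix_apply, (wordMatrix_stairWord x le_rfl _ _).2.2 (by simp) (by simp)
      (by have := hfg i j; simp only; omega), of_apply]
    have := (hfg i j).2
    simp only
    congr 2
    omega

end CrossingFree

/-! ### Embedding of stack polyominoes into the staircase -/

section Polyomino

open Matrix

/-- The largest row that meets one of the first `b` columns of `Λ`. -/
def columnHeight (Λ : Finset (ℕ+ × ℕ+)) (b : ℕ) : ℕ :=
  (Λ.filter fun p => (p.2 : ℕ) ≤ b).sup fun p => (p.1 : ℕ)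

/-- The first column that is met by the row `a` or a later one. -/
noncomputable def rowStart (Λ : Finset (ℕ+ × ℕ+)) (a : ℕ) : ℕ :=
  sInf {b | a ≤ columnHeight Λ b}

variable {Λ : Finset (ℕ+ × ℕ+)}

theorem columnHeight_mono : Monotone (columnHeight Λ) := by
  intro b b' h
  refine Finset.sup_mono fun p => ?_
  simp only [Finset.mem_filter]
  exact fun hp => ⟨hp.1, hp.2.trans h⟩

theorem le_columnHeight {a b : ℕ+} (h : (a, b) ∈ Λ) : (a : ℕ) ≤ columnHeight Λ b :=
  Finset.le_sup (f := fun p : ℕ+ × ℕ+ => (p.1 : ℕ))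
    (Finset.mem_filter.2 ⟨h, le_refl ((a, b).2 : ℕ)⟩)

theorem rowStart_le {a b : ℕ} (h : a ≤ columnHeight Λ b) : rowStart Λ a ≤ b :=
  Nat.sInf_le h

theorem rowStart_mono {a a' b : ℕ} (h : a' ≤ columnHeight Λ b) (haa' : a ≤ a') :
    rowStart Λ a ≤ rowStart Λ a' :=
  rowStart_le (haa'.trans (Nat.sInf_mem (s := {b | a' ≤ columnHeight Λ b}) ⟨b, h⟩))

/-- Some column up to `c` reaches row `a`, and row `a` is an interval that also contains `b`. -/
theorem IsStackPolyomino.mem_of_le_columnHeight (hΛ : IsStackPolyomino Λ) {a b c : ℕ+}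
    (hab : (a, b) ∈ Λ) (hcb : c ≤ b) (h : (a : ℕ) ≤ columnHeight Λ c) : (a, c) ∈ Λ := by
  obtain ⟨p, hp, hle⟩ := (Finset.le_sup_iff (by simp)).1 h
  rw [Finset.mem_filter] at hp
  have h1 : (a, p.2) ∈ Λ := hΛ.column p.1 p.2 hp.1 a (by exact_mod_cast hle)
  exact hΛ.row a p.2 b h1 hab c (by exact_mod_cast hp.2) hcb

/-- The position in the staircase of a cell. -/
noncomputable def stairPos (Λ : Finset (ℕ+ × ℕ+)) (p : ℕ+ × ℕ+) : ℕ × ℕ :=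
  (p.1 + rowStart Λ p.1, p.2 + columnHeight Λ p.2 + 1)

theorem stairPos_lt {p p' : ℕ+ × ℕ+} (h : (p.1 : ℕ) ≤ columnHeight Λ p'.2) :
    (stairPos Λ p).1 < (stairPos Λ p').2 := by
  have := rowStart_le h
  simp only [stairPos]
  omega

/-- The converse of `stairPos_lt`: if no column up to that of `p'` reaches the row of `p`, then
`rowStart` exceeds that column, and both summands of the first coordinate are too large. -/
theorem le_columnHeight_of_stairPos_lt {p p' : ℕ+ × ℕ+}
    (h : (stairPos Λ p).1 < (stairPos Λ p').2) (hp : p ∈ Λ) :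
    (p.1 : ℕ) ≤ columnHeight Λ p'.2 := by
  by_contra hlt
  have h1 : (p'.2 : ℕ) < rowStart Λ p.1 := by
    by_contra h2
    exact hlt ((Nat.sInf_mem (s := {b | (p.1 : ℕ) ≤ columnHeight Λ b})
      ⟨p.2, le_columnHeight hp⟩).trans (columnHeight_mono (not_lt.1 h2)))
  simp only [stairPos] at h
  omega

theorem fst_lt_of_stairPos_lt {p p' : ℕ+ × ℕ+} (hp : p ∈ Λ)
    (h : (stairPos Λ p).1 < (stairPos Λ p').1) : p.1 < p'.1 := by
  by_contra hlt
  have h1 : (p'.1 : ℕ) ≤ p.1 := by exact_mod_cast not_lt.1 hlt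
  have h2 := rowStart_mono (le_columnHeight (show (p.1, p.2) ∈ Λ from hp)) h1
  simp only [stairPos] at h
  omega

theorem snd_lt_of_stairPos_lt {p p' : ℕ+ × ℕ+}
    (h : (stairPos Λ p).2 < (stairPos Λ p').2) : p.2 < p'.2 := by
  by_contra hlt
  have h1 : (p'.2 : ℕ) ≤ p.2 := by exact_mod_cast not_lt.1 hlt
  have h2 := columnHeight_mono (Λ := Λ) h1
  simp only [stairPos] at h
  omega

theorem stairPos_injOn {p p' : ℕ+ × ℕ+} (hp : p ∈ Λ) (hp' : p' ∈ Λ)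
    (h : stairPos Λ p = stairPos Λ p') : p = p' := by
  have h1 : (stairPos Λ p).1 = (stairPos Λ p').1 := by rw [h]
  have h2 : (stairPos Λ p).2 = (stairPos Λ p').2 := by rw [h]
  simp only [stairPos] at h1 h2
  refine Prod.ext (PNat.coe_injective ?_) (PNat.coe_injective ?_)
  · rcases le_total (p.1 : ℕ) p'.1 with h | h
    · have := rowStart_mono (le_columnHeight (show (p'.1, p'.2) ∈ Λ from hp')) h
      omega
    · have := rowStart_mono (le_columnHeight (show (p.1, p.2) ∈ Λ from hp)) h
      omega
  · rcases le_total (p.2 : ℕ) p'.2 with h | h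
    · have := columnHeight_mono (Λ := Λ) h
      omega
    · have := columnHeight_mono (Λ := Λ) h
      omega

/-- Crossings in the staircase are diagonals in the polyomino. -/
theorem IsStackPolyomino.isDiagonal_of_crossing (hΛ : IsStackPolyomino Λ) {r : ℕ}
    (p : Fin r → ℕ+ × ℕ+) (hp : ∀ i, p i ∈ Λ)
    (h1 : StrictMono fun i => (stairPos Λ (p i)).1) (h2 : StrictMono fun i => (stairPos Λ (p i)).2)
    (h : ∀ i j, (stairPos Λ (p i)).1 < (stairPos Λ (p j)).2) :
    IsDiagonal Λ r (Finset.univ.image p) := by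
  have hb : StrictMono fun i => (p i).2 := fun i j hij => snd_lt_of_stairPos_lt (h2 hij)
  have ha : StrictMono fun i => (p i).1 := fun i j hij => fst_lt_of_stairPos_lt (hp i) (h1 hij)
  refine ⟨fun i => (p i).1, fun i => (p i).2, ha, hb, fun i j => ?_, rfl⟩
  -- For `i ≤ j` the position lies in column `b j` no further down than the cell `p j`. For `j ≤ i`
  -- the crossing condition supplies the height needed at column `b j`.
  rcases le_total i j with hij | hij
  · exact hΛ.column (p j).1 (p j).2 (hp j) _ (ha.monotone hij)
  · exact hΛ.mem_of_le_columnHeight (hp i) (hb.monotone hij)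
      (le_columnHeight_of_stairPos_lt (h i j) (hp i))

/-- A polynomial in the determinantal ideal all of whose monomials are supported on faces of the
complex is zero. -/
theorem eq_zero_of_mem_determinantalIdeal {k : Type*} [Field k] (hΛ : IsStackPolyomino Λ)
    {r : ℕ} (hr : 1 ≤ r) (F : MvPolynomial (Cell Λ) k) (hF : F ∈ determinantalIdeal k Λ r)
    (hstd : ∀ m ∈ F.support, m.support ∈ diagonalFreeComplex Λ r) : F = 0 := by
  -- The vanishing argument needs an infinite field.
  set K := AlgebraicClosure k
  set φ : k →+* K := algebraMap k K
  -- The supremum makes all cells fit into the triangle, and `2 * r` provides the room that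
  -- `middleRev` requires.
  set n : ℕ := 2 * r + Λ.sup fun p => (stairPos Λ p).2 with hn
  have hle : ∀ p ∈ Λ, (stairPos Λ p).2 ≤ n := fun p hp =>
    (Finset.le_sup (f := fun p => (stairPos Λ p).2) hp).trans (Nat.le_add_left _ _)
  have hmem : ∀ v : Cell Λ, Cell.pos v ∈ Λ := fun v => v.2
  refine (MvPolynomial.map_injective φ φ.injective) ?_
  rw [map_zero]
  refine eq_zero_of_vanishes_of_minors hr (n := n) (by omega) (fun v => stairPos Λ (Cell.pos v))
    (fun v w h => Cell.pos.injective (stairPos_injOn (hmem v) (hmem w) h)) (fun v =>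
      ⟨stairPos_lt (le_columnHeight (hmem v)), hle _ (hmem v)⟩) _ ?_ ?_
  · rintro m hm ⟨α, β, hα, hβ, hv, hαβ⟩
    choose v hv hvαβ using hv
    have h1 : ∀ i, (stairPos Λ (Cell.pos (v i))).1 = α i := fun i => by rw [hvαβ]
    have h2 : ∀ i, (stairPos Λ (Cell.pos (v i))).2 = β i := fun i => by rw [hvαβ]
    have hm' := hstd m (MvPolynomial.support_map_subset φ F hm)
    refine hm' ⟨_, hΛ.isDiagonal_of_crossing (fun i => Cell.pos (v i)) (fun i => hmem _)
      (by simpa only [h1] using hα) (by simpa only [h2] using hβ)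
      (by simpa only [h1, h2] using hαβ), ?_⟩
    intro p hp
    obtain ⟨i, -, rfl⟩ := Finset.mem_image.1 hp
    exact Finset.mem_map_of_mem _ (hv i)
  · intro x hx
    rw [MvPolynomial.eval_map]
    change (MvPolynomial.eval₂Hom φ fun v => x (stairPos Λ (Cell.pos v))) F = 0
    set ψ := MvPolynomial.eval₂Hom φ fun v : Cell Λ => x (stairPos Λ (Cell.pos v)) with hψ
    suffices determinantalIdeal k Λ r ≤ RingHom.ker ψ from RingHom.mem_ker.1 (this hF)
    refine Ideal.span_le.2 ?_
    rintro _ ⟨A, B, hA, hB, rfl⟩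
    rw [SetLike.mem_coe, RingHom.mem_ker, minorOf]
    split_ifs with hAB
    · have hmemAB : ∀ i j, (A.orderEmbOfFin hA i, B.orderEmbOfFin hB j) ∈ Λ := fun i j =>
        hAB (Finset.mem_product.2
          ⟨Finset.orderEmbOfFin_mem A hA i, Finset.orderEmbOfFin_mem B hB j⟩)
      -- The first coordinate of `stairPos` depends only on the row and the second only on the
      -- column, so a minor evaluates to a minor of the array.
      rw [RingHom.map_det, ← hx
        (fun i => (A.orderEmbOfFin hA i : ℕ) + rowStart Λ (A.orderEmbOfFin hA i))
        (fun j => (B.orderEmbOfFin hB j : ℕ) + columnHeight Λ (B.orderEmbOfFin hB j) + 1)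
        (fun i j => ⟨stairPos_lt (p := (A.orderEmbOfFin hA i, B.orderEmbOfFin hB j))
          (p' := (A.orderEmbOfFin hA i, B.orderEmbOfFin hB j)) (le_columnHeight (hmemAB i j)),
          hle _ (hmemAB i j)⟩)]
      congr 1
      ext i j
      simp only [RingHom.mapMatrix_apply, map_apply, submatrix_apply, genericMatrix,
        dif_pos (hmemAB i j), of_apply]
      exact MvPolynomial.eval₂_X _ _ _
    · exact map_zero _

end Polyomino

/-! ### Leading monomials of minors -/

section Leading

open Matrix

variable {Λ : Finset (ℕ+ × ℕ+)} {r : ℕ}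

/-- The cell at a given position. -/
def cellAt (p : ℕ+ × ℕ+) (h : p ∈ Λ) : Cell Λ := ⟨p, h⟩

@[simp]
theorem pos_cellAt (p : ℕ+ × ℕ+) (h : p ∈ Λ) : Cell.pos (cellAt p h) = p := rfl

theorem cellAt_pos (v : Cell Λ) : cellAt (Cell.pos v) v.2 = v := rfl

theorem cellAt_inj {p q : ℕ+ × ℕ+} {hp : p ∈ Λ} {hq : q ∈ Λ} :
    cellAt p hp = cellAt q hq ↔ p = q := by
  rw [← Cell.pos.injective.eq_iff, pos_cellAt, pos_cellAt]

/-- The exponent vector of the term of a minor that belongs to the permutation `σ`. -/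
noncomputable def permExponent (a b : Fin r → ℕ+) (h : ∀ i j, (a i, b j) ∈ Λ)
    (σ : Equiv.Perm (Fin r)) : Cell Λ →₀ ℕ :=
  ∑ i, Finsupp.single (cellAt (a (σ i), b i) (h (σ i) i)) 1

/-- Smaller variables lie in rows of larger index, and further left within a row. In the last row
where the two terms differ, the term of `σ` uses a column to the left of the diagonal one. This is
the smallest variable at which the exponents differ. -/
theorem permExponent_lt {a b : Fin r → ℕ+} (ha : StrictMono a) (hb : StrictMono b)
    (h : ∀ i j, (a i, b j) ∈ Λ) {σ : Equiv.Perm (Fin r)} (hσ : σ ≠ 1) :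
    (degRevLex (Cell Λ)).toSyn (permExponent a b h σ) <
      (degRevLex (Cell Λ)).toSyn (permExponent a b h 1) := by
  classical
  have hne : (Finset.univ.filter fun i => σ i ≠ i).Nonempty := by
    by_contra hcon
    rw [Finset.not_nonempty_iff_eq_empty, Finset.filter_eq_empty_iff] at hcon
    exact hσ (Equiv.ext fun i => by simpa using hcon (Finset.mem_univ i))
  obtain ⟨i, hi, hmax⟩ := Finset.exists_max_image _ id hne
  simp only [Finset.mem_filter_univ, id] at hi hmax
  have hfix : ∀ j, i < j → σ j = j := fun j hj => by
    by_contra hcon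
    exact (hmax j hcon).not_gt hj
  obtain ⟨l, rfl⟩ := σ.surjective i
  -- All indices beyond the largest moved index `σ l` are fixed, so its preimage `l` must be
  -- smaller.
  have hl : l < σ l := by
    rcases lt_trichotomy l (σ l) with h1 | h1 | h1
    · exact h1
    · exact absurd (by rw [← h1, ← h1]) hi
    · exact absurd (hfix l h1) (fun h2 => h1.ne h2)
  refine DegRevLex.lt_def.2 (Or.inr ⟨?_, cellAt (a (σ l), b l) (h _ _), ?_, ?_⟩)
  · simp only [permExponent, map_sum, Finsupp.degree_single]
  · intro y hy
    obtain ⟨⟨y1, y2⟩, hyΛ, rfl⟩ : ∃ p hp, y = cellAt p hp := ⟨_, _, (cellAt_pos y).symm⟩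
    simp only [permExponent, Finsupp.finsetSum_apply, Finsupp.single_apply]
    refine Finset.sum_congr rfl fun j _ => if_congr ?_ rfl rfl
    rw [cellAt_inj, cellAt_inj, Prod.mk.injEq, Prod.mk.injEq, Equiv.Perm.one_apply]
    have hy := Cell.lt_def.1 hy
    simp only [pos_cellAt] at hy
    rcases hy with hlt | ⟨heq, hlt⟩
    · constructor
      · rintro ⟨rfl, rfl⟩
        have h1 := σ.injective (hfix _ (ha.lt_iff_lt.1 hlt))
        exact ⟨by rw [h1], rfl⟩
      · rintro ⟨rfl, rfl⟩
        have h1 := hfix _ (ha.lt_iff_lt.1 hlt)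
        exact ⟨by rw [h1], rfl⟩
    · constructor
      · rintro ⟨h1, rfl⟩
        rw [heq] at h1
        exact absurd hlt (by rw [σ.injective (ha.injective h1)]; exact lt_irrefl _)
      · rintro ⟨h1, rfl⟩
        rw [heq] at h1
        have h2 : j = σ l := ha.injective h1
        exact absurd (hb.lt_iff_lt.1 hlt) (by rw [h2]; exact hl.not_gt)
  · simp only [permExponent, Finsupp.finsetSum_apply, Finsupp.single_apply]
    refine (Finset.sum_eq_zero fun j _ => if_neg fun hj => ?_).trans_lt
      (Finset.sum_pos' (fun _ _ => Nat.zero_le _) ⟨l, Finset.mem_univ _, by simp⟩)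
    have h1 := cellAt_inj.1 hj
    have h2 := ha.injective (congrArg Prod.fst h1)
    have h3 := hb.injective (congrArg Prod.snd h1)
    exact hl.ne (h3 ▸ h2)

/-- The minor with rows `a i` and columns `b j`. -/
noncomputable def cellMinor (k : Type*) [Field k] (a b : Fin r → ℕ+)
    (h : ∀ i j, (a i, b j) ∈ Λ) : MvPolynomial (Cell Λ) k :=
  (Matrix.of fun i j => MvPolynomial.X (cellAt (a i, b j) (h i j))).det

variable {k : Type*} [Field k]

theorem cellMinor_eq_sum (a b : Fin r → ℕ+) (h : ∀ i j, (a i, b j) ∈ Λ) :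
    cellMinor k a b h =
      ∑ σ : Equiv.Perm (Fin r), MvPolynomial.monomial (permExponent a b h σ)
        ((Equiv.Perm.sign σ : ℤ) : k) := by
  rw [cellMinor, det_apply]
  refine Finset.sum_congr rfl fun σ _ => ?_
  rw [permExponent, ← mul_one ((Equiv.Perm.sign σ : ℤ) : k), ← smul_eq_mul,
    ← MvPolynomial.smul_monomial, MvPolynomial.monomial_sum_one, Units.smul_def,
    ← Int.cast_smul_eq_zsmul k]
  rfl

theorem cellMinor_mem (a b : Fin r → ℕ+) (ha : StrictMono a) (hb : StrictMono b)
    (h : ∀ i j, (a i, b j) ∈ Λ) : cellMinor k a b h ∈ determinantalIdeal k Λ r := by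
  classical
  refine Ideal.subset_span ⟨Finset.univ.image a, Finset.univ.image b,
    by rw [Finset.card_image_of_injective _ ha.injective, Finset.card_fin],
    by rw [Finset.card_image_of_injective _ hb.injective, Finset.card_fin], ?_⟩
  rw [minorOf, if_pos]
  · rw [← Finset.orderEmbOfFin_unique _ (f := a) (fun i => by simp) ha,
      ← Finset.orderEmbOfFin_unique _ (f := b) (fun i => by simp) hb, cellMinor]
    congr 1
    refine Matrix.ext fun i j => ?_
    rw [submatrix_apply, genericMatrix, dif_pos (h i j)]
    rfl
  · rintro ⟨p, q⟩ hpq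
    obtain ⟨hp, hq⟩ := Finset.mem_product.1 hpq
    obtain ⟨i, -, rfl⟩ := Finset.mem_image.1 hp
    obtain ⟨j, -, rfl⟩ := Finset.mem_image.1 hq
    exact h i j

theorem coeff_cellMinor {a b : Fin r → ℕ+} (ha : StrictMono a) (hb : StrictMono b)
    (h : ∀ i j, (a i, b j) ∈ Λ) :
    (cellMinor k a b h).coeff (permExponent a b h 1) = 1 := by
  classical
  rw [cellMinor_eq_sum, MvPolynomial.coeff_sum, Finset.sum_eq_single 1]
  · simp
  · intro σ _ hσ
    rw [MvPolynomial.coeff_monomial, if_neg]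
    intro heq
    have := permExponent_lt ha hb h hσ
    rw [heq] at this
    exact lt_irrefl _ this
  · simp

theorem degree_cellMinor {a b : Fin r → ℕ+} (ha : StrictMono a) (hb : StrictMono b)
    (h : ∀ i j, (a i, b j) ∈ Λ) :
    (degRevLex (Cell Λ)).degree (cellMinor k a b h) = permExponent a b h 1 := by
  classical
  refine (degRevLex (Cell Λ)).toSyn.injective (le_antisymm ?_ ?_)
  · rw [MonomialOrder.degree_le_iff]
    intro m hm
    rw [cellMinor_eq_sum] at hm
    obtain ⟨σ, -, hσ⟩ := Finset.mem_biUnion.1 (MvPolynomial.support_sum hm)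
    rw [Finset.mem_singleton.1 (MvPolynomial.support_monomial_subset hσ)]
    by_cases h1 : σ = 1
    · rw [h1]
    · exact (permExponent_lt ha hb h h1).le
  · refine MonomialOrder.le_degree ?_
    rw [MvPolynomial.mem_support_iff, coeff_cellMinor ha hb]
    exact one_ne_zero

theorem leadingCoeff_cellMinor {a b : Fin r → ℕ+} (ha : StrictMono a) (hb : StrictMono b)
    (h : ∀ i j, (a i, b j) ∈ Λ) :
    (degRevLex (Cell Λ)).leadingCoeff (cellMinor k a b h) = 1 := by
  rw [MonomialOrder.leadingCoeff, degree_cellMinor ha hb, coeff_cellMinor ha hb]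

end Leading

/-! ### The initial ideal -/

section Initial

variable {V k : Type*} [Field k]

/-- The exponent vector of a squarefree monomial. -/
noncomputable def setExponent (σ : Finset V) : V →₀ ℕ :=
  ∑ v ∈ σ, Finsupp.single v 1

theorem setExponent_apply [DecidableEq V] (σ : Finset V) (v : V) :
    setExponent σ v = if v ∈ σ then 1 else 0 := by
  simp [setExponent, Finsupp.finsetSum_apply, Finsupp.single_apply]

theorem setExponent_le_iff {σ : Finset V} {m : V →₀ ℕ} :
    setExponent σ ≤ m ↔ σ ⊆ m.support := by
  classical
  constructor
  · intro h v hv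
    have := h v
    rw [setExponent_apply, if_pos hv] at this
    exact Finsupp.mem_support_iff.2 (by omega)
  · intro h v
    rw [setExponent_apply]
    split_ifs with hv
    · exact Nat.one_le_iff_ne_zero.2 (Finsupp.mem_support_iff.1 (h hv))
    · exact Nat.zero_le _

theorem prod_X_eq_monomial (σ : Finset V) :
    ∏ v ∈ σ, (MvPolynomial.X v : MvPolynomial V k) =
      MvPolynomial.monomial (setExponent σ) 1 := by
  rw [setExponent, MvPolynomial.monomial_sum_one]
  rfl

theorem monomial_mem_of_le {I : Ideal (MvPolynomial V k)} {m m' : V →₀ ℕ}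
    (h : MvPolynomial.monomial m (1 : k) ∈ I) (hle : m ≤ m') :
    MvPolynomial.monomial m' (1 : k) ∈ I := by
  rw [← tsub_add_cancel_of_le hle, ← mul_one (1 : k), ← MvPolynomial.monomial_mul]
  exact I.mul_mem_left _ h

theorem isSquarefreeMonomialIdeal_stanleyReisnerIdeal (Δ : LowerSet (Finset V)) :
    IsSquarefreeMonomialIdeal (stanleyReisnerIdeal k Δ) := by
  classical
  refine ⟨setExponent '' {σ | σ ∉ Δ}, ?_, ?_⟩
  · rintro _ ⟨σ, -, rfl⟩ v
    rw [setExponent_apply]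
    split_ifs <;> simp
  · rw [stanleyReisnerIdeal, Set.image_image]
    congr 1
    ext f
    simp only [Set.mem_image, prod_X_eq_monomial]
    exact exists_congr fun σ => and_congr_right fun _ => eq_comm

variable {Λ : Finset (ℕ+ × ℕ+)} {r : ℕ}

/-- The cells of a diagonal. -/
def diagonalCells (a b : Fin r → ℕ+) (ha : StrictMono a) (h : ∀ i j, (a i, b j) ∈ Λ) :
    Fin r ↪ Cell Λ :=
  ⟨fun i => cellAt (a i, b i) (h i i), fun _ _ hij =>
    ha.injective (congrArg Prod.fst (cellAt_inj.1 hij))⟩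

theorem permExponent_one {a b : Fin r → ℕ+} (ha : StrictMono a) (h : ∀ i j, (a i, b j) ∈ Λ) :
    permExponent a b h 1 = setExponent (Finset.univ.map (diagonalCells a b ha h)) := by
  rw [setExponent, Finset.sum_map]
  rfl

/-- The faces of the complex are the sets whose monomials are not divisible by a leading monomial
of a minor. -/
theorem notMem_diagonalFreeComplex_iff {σ : Finset (Cell Λ)} :
    σ ∉ diagonalFreeComplex Λ r ↔ ∃ (a b : Fin r → ℕ+) (_ : StrictMono a) (_ : StrictMono b)
      (h : ∀ i j, (a i, b j) ∈ Λ), ∀ i, cellAt (a i, b i) (h i i) ∈ σ := by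
  change ¬ ¬ (∃ τ, IsDiagonal Λ r τ ∧ τ ⊆ σ.map Cell.pos) ↔ _
  rw [not_not]
  constructor
  · rintro ⟨_, ⟨a, b, ha, hb, h, rfl⟩, hsub⟩
    refine ⟨a, b, ha, hb, h, fun i => ?_⟩
    obtain ⟨v, hv, hvi⟩ := Finset.mem_map.1 (hsub (Finset.mem_image_of_mem _ (Finset.mem_univ i)))
    have : v = cellAt (a i, b i) (h i i) := Cell.pos.injective hvi
    rwa [← this]
  · rintro ⟨a, b, ha, hb, h, hσ⟩
    refine ⟨_, ⟨a, b, ha, hb, h, rfl⟩, fun p hp => ?_⟩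
    obtain ⟨i, -, rfl⟩ := Finset.mem_image.1 hp
    exact Finset.mem_map.2 ⟨_, hσ i, rfl⟩

theorem stanleyReisnerIdeal_le_initialIdeal :
    stanleyReisnerIdeal k (diagonalFreeComplex Λ r) ≤
      initialIdeal (degRevLex (Cell Λ)) (determinantalIdeal k Λ r) := by
  refine Ideal.span_le.2 ?_
  rintro _ ⟨σ, hσ, rfl⟩
  obtain ⟨a, b, ha, hb, h, hmem⟩ := notMem_diagonalFreeComplex_iff.1 hσ
  rw [SetLike.mem_coe, prod_X_eq_monomial]
  refine monomial_mem_of_le (m := permExponent a b h 1) (Ideal.subset_span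
    ⟨cellMinor k a b h, cellMinor_mem a b ha hb h, ?_⟩) ?_
  · rw [leadingMonomial, if_neg, degree_cellMinor ha hb]
    intro h0
    have := coeff_cellMinor (k := k) ha hb h
    simp [h0] at this
  · classical
    rw [permExponent_one ha, setExponent_le_iff]
    intro v hv
    obtain ⟨i, -, rfl⟩ := Finset.mem_map.1 hv
    rw [Finsupp.mem_support_iff, setExponent_apply]
    exact (if_pos (hmem i)).trans_ne one_ne_zero

/-- Division by the minors is possible since their leading coefficients are one. No monomial of the
remainder is divisible by a diagonal, so the remainder is supported on faces and vanishes. -/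
theorem initialIdeal_le_stanleyReisnerIdeal (hΛ : IsStackPolyomino Λ) (hr : 1 ≤ r) :
    initialIdeal (degRevLex (Cell Λ)) (determinantalIdeal k Λ r) ≤
      stanleyReisnerIdeal k (diagonalFreeComplex Λ r) := by
  refine Ideal.span_le.2 ?_
  rintro _ ⟨f, hf, rfl⟩
  rw [SetLike.mem_coe, leadingMonomial]
  split_ifs with hf0
  · exact Ideal.zero_mem _
  set B : Set (MvPolynomial (Cell Λ) k) := {g | ∃ (a b : Fin r → ℕ+) (_ : StrictMono a)
    (_ : StrictMono b) (h : ∀ i j, (a i, b j) ∈ Λ), g = cellMinor k a b h} with hB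
  obtain ⟨g, rem, hfg, hdeg, hrem⟩ := (degRevLex (Cell Λ)).div_set (B := B) (by
    rintro _ ⟨a, b, ha, hb, h, rfl⟩
    rw [leadingCoeff_cellMinor ha hb]
    exact isUnit_one) f
  have hcomb : Finsupp.linearCombination _ (fun b : B => (b : MvPolynomial (Cell Λ) k)) g ∈
      determinantalIdeal k Λ r := by
    rw [Finsupp.linearCombination_apply, Finsupp.sum]
    refine Ideal.sum_mem _ fun b _ => ?_
    obtain ⟨_, a, b, ha, hb, h, rfl⟩ := b
    exact Ideal.mul_mem_left _ _ (cellMinor_mem a b ha hb h)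
  have hrem0 : rem = 0 := by
    refine eq_zero_of_mem_determinantalIdeal hΛ hr rem ?_ fun m hm => ?_
    · have : rem = f - Finsupp.linearCombination _
          (fun b : B => (b : MvPolynomial (Cell Λ) k)) g := by rw [hfg]; ring
      rw [this]
      exact Ideal.sub_mem _ hf hcomb
    · by_contra hcon
      obtain ⟨a, b, ha, hb, h, hmem⟩ := notMem_diagonalFreeComplex_iff.1 hcon
      refine hrem m hm _ ⟨a, b, ha, hb, h, rfl⟩ ?_
      rw [degree_cellMinor ha hb, permExponent_one ha, setExponent_le_iff]
      intro v hv
      obtain ⟨i, -, rfl⟩ := Finset.mem_map.1 hv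
      exact hmem i
  -- The leading monomial of `f` occurs in some summand of the quotient expression. The degree bound
  -- of the division makes it the leading monomial of that summand, hence a multiple of a diagonal.
  have hcoeff := (degRevLex (Cell Λ)).leadingCoeff_ne_zero_iff.2 hf0
  rw [MonomialOrder.leadingCoeff] at hcoeff
  set d := (degRevLex (Cell Λ)).degree f with hd
  rw [hfg, hrem0, add_zero, Finsupp.linearCombination_apply, Finsupp.sum,
    MvPolynomial.coeff_sum] at hcoeff
  obtain ⟨⟨_, a, b, ha, hb, h, rfl⟩, -, hne⟩ := Finset.exists_ne_zero_of_sum_ne_zero hcoeff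
  rw [smul_eq_mul, mul_comm] at hne
  have hle := hdeg ⟨cellMinor k a b h, a, b, ha, hb, h, rfl⟩
  have hge := (degRevLex (Cell Λ)).le_degree (MvPolynomial.mem_support_iff.2 hne)
  have heq := (degRevLex (Cell Λ)).toSyn.injective (le_antisymm hle hge)
  have hne0 : cellMinor k a b h * g ⟨cellMinor k a b h, a, b, ha, hb, h, rfl⟩ ≠ 0 := by
    intro h0
    rw [h0] at hne
    simp at hne
  rw [← heq, MonomialOrder.degree_mul (left_ne_zero_of_mul hne0) (right_ne_zero_of_mul hne0),
    degree_cellMinor ha hb, permExponent_one ha]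
  refine monomial_mem_of_le (Ideal.subset_span ⟨_, ?_, (prod_X_eq_monomial _).symm⟩)
    le_self_add
  refine notMem_diagonalFreeComplex_iff.2 ⟨a, b, ha, hb, h, fun i => ?_⟩
  exact Finset.mem_map.2 ⟨i, Finset.mem_univ _, rfl⟩

end Initial

theorem theorem5p4 (k : Type*) [Field k] (Λ : Finset (ℕ+ × ℕ+)) (hΛ : IsStackPolyomino Λ)
    (r : ℕ) (hr : 1 ≤ r) :
    initialIdeal (degRevLex (Cell Λ)) (determinantalIdeal k Λ r) =
        stanleyReisnerIdeal k (diagonalFreeComplex Λ r) ∧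
      IsSquarefreeMonomialIdeal
        (initialIdeal (degRevLex (Cell Λ)) (determinantalIdeal k Λ r)) := by
  have h := le_antisymm (initialIdeal_le_stanleyReisnerIdeal (k := k) hΛ hr)
    stanleyReisnerIdeal_le_initialIdeal
  exact ⟨h, h ▸ isSquarefreeMonomialIdeal_stanleyReisnerIdeal _⟩
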